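/- Let $0<a<1/6$ and let $F:\mathbb{R}^2\to\mathbb{R}^2$, $F(x,y)=(x+2a\sin x+a\sin y,\; y+a\sin x+2a\sin y)$. A fixed point of $F$ is called a sink if all eigenvalues of the derivative of $F$ there have modulus $<1$, a repeller if they all have modulus $>1$, and a saddle if none has modulus $1$, at least one has modulus $<1$ and at least one has modulus $>1$. A heteroclinic curve from a fixed point $p$ to a fixed point $q$ is a set $C$ with $F(C)=C$ that is the image of a continuous injective map $\gamma:\mathbb{R}\to\mathbb{R}^2$ with $\gamma(t)\to p$ as $t\to-\infty$ and $\gamma(t)\to q$ as $t\to+\infty$, and such that every $z\in C$ has a full orbit $(X_n)_{n\in\mathbb{Z}}$ ($X_0=z$, $X_{n+1}=F(X_n)$) with $X_n\to p$ as $n\to-\infty$ and $X_n\to q$ as $n\to+\infty$. Then $(\pi,\pi)$ is a sink of $F$, and its basin of attraction $A=\{z: F^n(z)\to(\pi,\pi) \text{ as } n\to\infty\}$ is a bounded, simply connected open set containing $(\pi,\pi)$ with the following properties. 1. The points $(0,0)$, $(0,2\pi)$, $(2\pi,0)$, $(2\pi,2\pi)$ belong to $\partial A$ and are repellers. The points $(0,\pi)$,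 $(\pi,0)$, $(\pi,2\pi)$, $(2\pi,\pi)$ belong to $\partial A$ and are saddles in $\overline{A}$: each such $q$ is a saddle of $F$, and $\overline{A}\setminus\{q\}$ contains a point whose forward orbit converges to $q$ and a point with a full orbit that converges to $q$ in backward time. 2. $\partial A$ is the union of these eight points and of eight heteroclinic curves, one from each of the four repellers to each of the two adjacent saddles: from $(2\pi i,2\pi j)$ to $(\pi,2\pi j)$ and from $(2\pi i,2\pi j)$ to $(2\pi i,\pi)$, for $i,j\in\{0,1\}$. 3. $F(\partial A)=\partial A$. 4. The translates $\overline{A}^{\,l,k}=\overline{A}+(2\pi l,2\pi k)$, $(l,k)\in\mathbb{Z}^2$, tile the plane: they are closed sets with nonempty interior, their union is $\mathbb{R}^2$, and translates with different $(l,k)$ have disjoint interiors. Moreover $F(\overline{A}^{\,l,k})=\overline{A}^{\,l,k}$, and the translation by $(2\pi l,2\pi k)$ commutes with $F$, so that the dynamics on every tile is the same as on $\overline{A}$. -/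

import Mathlib

open Filter Topology

noncomputable section

namespace AlignedClocks

/-- The map `F` of the phase differences of three aligned clocks, with coupling parameter `a`. -/
def F (a : ℝ) (z : ℝ × ℝ) : ℝ × ℝ :=
  (z.1 + 2 * a * Real.sin z.1 + a * Real.sin z.2,
   z.2 + a * Real.sin z.1 + 2 * a * Real.sin z.2)

/-- The complex eigenvalues of the derivative of `f` at `p`. -/
def multipliers (f : ℝ × ℝ → ℝ × ℝ) (p : ℝ × ℝ) : Set ℂ :=
  {μ | μ ∈ ((fderiv ℝ f p : ℝ × ℝ →L[ℝ] ℝ × ℝ) : ℝ × ℝ →ₗ[ℝ] ℝ × ℝ).charpoly.aroots ℂ}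

/-- Hyperbolic sink: a fixed point all of whose multipliers have modulus less than one. -/
def IsSink (f : ℝ × ℝ → ℝ × ℝ) (p : ℝ × ℝ) : Prop :=
  f p = p ∧ DifferentiableAt ℝ f p ∧ ∀ μ ∈ multipliers f p, ‖μ‖ < 1

/-- Hyperbolic repeller: a fixed point all of whose multipliers have modulus greater than one. -/
def IsRepeller (f : ℝ × ℝ → ℝ × ℝ) (p : ℝ × ℝ) : Prop :=
  f p = p ∧ DifferentiableAt ℝ f p ∧ ∀ μ ∈ multipliers f p, 1 < ‖μ‖

/-- Hyperbolic saddle: a fixed point without multipliers of modulus one, having multipliers both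
inside and outside the unit circle. -/
def IsSaddle (f : ℝ × ℝ → ℝ × ℝ) (p : ℝ × ℝ) : Prop :=
  f p = p ∧ DifferentiableAt ℝ f p ∧ (∀ μ ∈ multipliers f p, ‖μ‖ ≠ 1) ∧
    (∃ μ ∈ multipliers f p, ‖μ‖ < 1) ∧ (∃ μ ∈ multipliers f p, 1 < ‖μ‖)

/-- A full (two-sided) orbit of `f`. -/
def IsOrbit (f : ℝ × ℝ → ℝ × ℝ) (X : ℤ → ℝ × ℝ) : Prop :=
  ∀ n : ℤ, X (n + 1) = f (X n)

/-- The points whose forward orbit converges to `p`: the stable set of `p`, which is the basin of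
attraction of `p` when `p` is a sink. -/
def basin (f : ℝ × ℝ → ℝ × ℝ) (p : ℝ × ℝ) : Set (ℝ × ℝ) :=
  {z | Tendsto (fun n : ℕ => f^[n] z) atTop (𝓝 p)}

/-- The points that have a full orbit converging to `p` in backward time. -/
def unstableSet (f : ℝ × ℝ → ℝ × ℝ) (p : ℝ × ℝ) : Set (ℝ × ℝ) :=
  {z | ∃ X : ℤ → ℝ × ℝ, IsOrbit f X ∧ X 0 = z ∧ Tendsto X atBot (𝓝 p)}

/-- `p` is a repeller in `S`: a point of `S` that is a hyperbolic repeller. -/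
def IsRepellerIn (f : ℝ × ℝ → ℝ × ℝ) (S : Set (ℝ × ℝ)) (p : ℝ × ℝ) : Prop :=
  p ∈ S ∧ IsRepeller f p

/-- `p` is a saddle in `S`: a point of `S` that is a hyperbolic saddle and such that both the
attracting and the repelling behaviour at `p` are present inside `S`. -/
def IsSaddleIn (f : ℝ × ℝ → ℝ × ℝ) (S : Set (ℝ × ℝ)) (p : ℝ × ℝ) : Prop :=
  p ∈ S ∧ IsSaddle f p ∧ (∃ z ∈ S, z ≠ p ∧ z ∈ basin f p) ∧
    (∃ z ∈ S, z ≠ p ∧ z ∈ unstableSet f p)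

/-- `C` is a heteroclinic curve of `f` from `p` to `q`: an invariant open arc without
self-intersections whose two ends are `p` and `q`, all of whose points lie on full orbits that
converge to `p` in backward time and to `q` in forward time. -/
def IsHeteroclinicCurve (f : ℝ × ℝ → ℝ × ℝ) (p q : ℝ × ℝ) (C : Set (ℝ × ℝ)) : Prop :=
  (∃ γ : ℝ → ℝ × ℝ, Continuous γ ∧ Function.Injective γ ∧ Set.range γ = C ∧
    Tendsto γ atBot (𝓝 p) ∧ Tendsto γ atTop (𝓝 q)) ∧
  f '' C = C ∧
  ∀ z ∈ C, ∃ X : ℤ → ℝ × ℝ, IsOrbit f X ∧ X 0 = z ∧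
    Tendsto X atBot (𝓝 p) ∧ Tendsto X atTop (𝓝 q)

/-- The translation by `(2πl, 2πk)`. -/
def translation (l k : ℤ) (z : ℝ × ℝ) : ℝ × ℝ :=
  (z.1 + 2 * Real.pi * l, z.2 + 2 * Real.pi * k)

/-- A family of sets tiles the plane: the members are closed with nonempty interior, they cover
the plane, and members with different indices have disjoint interiors. -/
def IsTiling {ι : Type} (T : ι → Set (ℝ × ℝ)) : Prop :=
  (∀ i, IsClosed (T i) ∧ (interior (T i)).Nonempty) ∧ (⋃ i, T i) = Set.univ ∧
    ∀ i j, i ≠ j → Disjoint (interior (T i)) (interior (T j))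

/-- The four points `(0,0)`, `(0,2π)`, `(2π,0)`, `(2π,2π)`. -/
def corner (i j : Fin 2) : ℝ × ℝ := (2 * Real.pi * (i : ℕ), 2 * Real.pi * (j : ℕ))

/-- The two points `(π,0)`, `(π,2π)`. -/
def midH (j : Fin 2) : ℝ × ℝ := (Real.pi, 2 * Real.pi * (j : ℕ))

/-- The two points `(0,π)`, `(2π,π)`. -/
def midV (i : Fin 2) : ℝ × ℝ := (2 * Real.pi * (i : ℕ), Real.pi)

end AlignedClocks

end

/-!
In the half sum and half difference of the two phases, centred at the saddle `(0, π)`, the map `F a`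
becomes `(u, v) ↦ (u + b cos u sin v, v + c sin u cos v)` with `b = 3a` and `c = a`. For `b, c < 1`
it is a homeomorphism, and it preserves the coordinatewise order on `Q = [-π/2, π/2]²`, whose
upper right and lower left vertices are sinks, whose other two vertices are repellers and whose
centre is a saddle. In each quadrant of `Q` the orbits that stay there are monotone in both
coordinates, so they converge to fixed points, and every point of `Q` is attracted to one of the two
sinks or lies on the separatrix, which consists of the stable set of the saddle and the two
repellers. By monotonicity no two points of the separatrix are comparable, and by connectedness
every vertical and every horizontal line of `Q` meets it: it is the graph of a continuous strictly
decreasing function.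

Folding the plane along `u = π/2` and `v = π/2` commutes with the map and does not change the
distance to the upper right sink. The basin of that sink is therefore the preimage under the fold of
the region above the separatrix. It is star-shaped about the sink, because folding turns segments
ending there into segments, which are increasing in `Q`; and its boundary consists of four copies of
the separatrix, that is, of eight half-branches of stable sets of saddles, on each of which the
backward orbits are monotone and converge to a repeller. The separatrix is symmetric about the
origin, so a point of `Q` lies above it or its image under a translation by `π` in one coordinate
folds to a point above it; hence the translates of the closed basin cover the plane.
-/

noncomputable section

namespace AlignedClocks

open Real Set Function

/-! ### Orbits and stable sets -/

section Iteration

variable {f g φ : ℝ × ℝ → ℝ × ℝ} {p q z : ℝ × ℝ} {S C : Set (ℝ × ℝ)}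

lemma map_mem_basin_iff : f z ∈ basin f p ↔ z ∈ basin f p :=
  tendsto_add_atTop_iff_nat (f := fun n : ℕ => f^[n] z) 1

lemma iterate_mem_basin_iff (n : ℕ) : f^[n] z ∈ basin f p ↔ z ∈ basin f p := by
  induction n with
  | zero => rfl
  | succ n ih => rw [iterate_succ_apply', map_mem_basin_iff, ih]

lemma eq_of_mem_basin (hp : z ∈ basin f p) (hq : z ∈ basin f q) : p = q :=
  tendsto_nhds_unique hp hq

lemma self_mem_basin (hp : IsFixedPt f p) : p ∈ basin f p := by
  change Tendsto (fun n => f^[n] p) atTop (𝓝 p)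
  simpa only [fun n => (hp.iterate n).eq] using tendsto_const_nhds

lemma exists_iterate_mem_of_mem_basin (hz : z ∈ basin f p) (hS : S ∈ 𝓝 p) : ∃ n, f^[n] z ∈ S :=
  (hz.eventually hS).exists

lemma mem_of_mem_basin (hz : z ∈ basin f p) (hS : S ∈ 𝓝 p) (h : ∀ w, f w ∈ S → w ∈ S) :
    z ∈ S := by
  have key (n : ℕ) : f^[n] z ∈ S → z ∈ S := by
    induction n with
    | zero => exact id
    | succ n ih => exact fun hn => ih (h _ (iterate_succ_apply' f n z ▸ hn))
  obtain ⟨n, hn⟩ := exists_iterate_mem_of_mem_basin hz hS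
  exact key n hn

lemma mem_basin_of_semiconj (hφ : Continuous φ) (h : Semiconj φ f g) (hz : z ∈ basin f p) :
    φ z ∈ basin g (φ p) :=
  ((hφ.tendsto p).comp hz).congr fun n => (h.iterate_right n).eq z

lemma mem_unstableSet_of_semiconj (hφ : Continuous φ) (h : Semiconj φ f g)
    (hz : z ∈ unstableSet f p) : φ z ∈ unstableSet g (φ p) := by
  obtain ⟨X, hX, rfl, hbot⟩ := hz
  exact ⟨φ ∘ X, fun n => by rw [comp_apply, hX n, h.eq]; rfl, rfl, (hφ.tendsto p).comp hbot⟩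

lemma IsHeteroclinicCurve.image_of_semiconj (hC : IsHeteroclinicCurve f p q C)
    (hφ : Continuous φ) (hi : Injective φ) (h : Semiconj φ f g) :
    IsHeteroclinicCurve g (φ p) (φ q) (φ '' C) := by
  obtain ⟨⟨γ, hγ, hγi, rfl, hbot, htop⟩, hf, horb⟩ := hC
  refine ⟨⟨φ ∘ γ, hφ.comp hγ, hi.comp hγi, range_comp φ γ, (hφ.tendsto p).comp hbot,
    (hφ.tendsto q).comp htop⟩, ?_, ?_⟩
  · rw [← image_comp, ← h.comp_eq, image_comp, hf]
  · rintro _ ⟨z, hz, rfl⟩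
    obtain ⟨X, hX, rfl, hXbot, hXtop⟩ := horb z hz
    exact ⟨φ ∘ X, fun n => by rw [comp_apply, hX n, h.eq]; rfl, rfl, (hφ.tendsto p).comp hXbot,
      (hφ.tendsto q).comp hXtop⟩

lemma exists_isFixedPt_mem_basin (hf : Continuous f) (hS : IsCompact S)
    (hz : ∀ n, f^[n] z ∈ S)
    (h₁ : Monotone (fun n => (f^[n] z).1) ∨ Antitone (fun n => (f^[n] z).1))
    (h₂ : Monotone (fun n => (f^[n] z).2) ∨ Antitone (fun n => (f^[n] z).2)) :
    ∃ p ∈ S, IsFixedPt f p ∧ z ∈ basin f p := by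
  have converges {x : ℕ → ℝ} (hx : Monotone x ∨ Antitone x) {T : Set ℝ} (hT : IsCompact T)
      (hxT : ∀ n, x n ∈ T) : ∃ l, Tendsto x atTop (𝓝 l) :=
    hx.elim
      (fun h => ⟨_, tendsto_atTop_ciSup h (hT.bddAbove.mono (range_subset_iff.2 hxT))⟩)
      (fun h => ⟨_, tendsto_atTop_ciInf h (hT.bddBelow.mono (range_subset_iff.2 hxT))⟩)
  obtain ⟨l₁, hl₁⟩ := converges h₁ (hS.image continuous_fst) fun n => mem_image_of_mem _ (hz n)
  obtain ⟨l₂, hl₂⟩ := converges h₂ (hS.image continuous_snd) fun n => mem_image_of_mem _ (hz n)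
  have hl : z ∈ basin f (l₁, l₂) := hl₁.prodMk_nhds hl₂
  exact ⟨(l₁, l₂), hS.isClosed.mem_of_tendsto hl (.of_forall hz),
    isFixedPt_of_tendsto_iterate hl hf.continuousAt, hl⟩

end Iteration

lemma exists_forall_iterate_notMem {X : Type*} [TopologicalSpace X] {f : X → X} {s U V : Set X}
    (hf : Continuous f) (hs : IsPreconnected s) (hU : IsOpen U) (hV : IsOpen V)
    (hsU : ∃ x ∈ s, ∃ n, f^[n] x ∈ U) (hsV : ∃ x ∈ s, ∃ n, f^[n] x ∈ V)
    (hUV : ∀ x ∈ s, ∀ m n, f^[m] x ∈ U → f^[n] x ∉ V) :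
    ∃ x ∈ s, ∀ n, f^[n] x ∉ U ∧ f^[n] x ∉ V := by
  have hopen {W : Set X} (hW : IsOpen W) : IsOpen {x | ∃ n, f^[n] x ∈ W} := by
    rw [ofPred_exists]
    exact isOpen_iUnion fun n => hW.preimage (hf.iterate n)
  by_contra! hcover
  obtain ⟨x, hx, ⟨m, hm⟩, n, hn⟩ := hs _ _ (hopen hU) (hopen hV)
    (fun x hx => by
      obtain ⟨n, hn⟩ := hcover x hx
      exact (em (f^[n] x ∈ U)).imp (fun h => ⟨n, h⟩) fun h => ⟨n, hn h⟩) hsU hsV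
  exact hUV x hx m n hm hn

section FullOrbit

variable (f : ℝ × ℝ ≃ₜ ℝ × ℝ) {p q z : ℝ × ℝ}

/-- The full orbit of `z` under the homeomorphism `f`, with `z` at time `0`. -/
def fullOrbit (z : ℝ × ℝ) (n : ℤ) : ℝ × ℝ := (f ^ n) z

lemma isOrbit_fullOrbit : IsOrbit f (fullOrbit f z) := fun n => by
  rw [fullOrbit, fullOrbit, add_comm, zpow_one_add]
  rfl

lemma fullOrbit_zero : fullOrbit f z 0 = z := by
  rw [fullOrbit, zpow_zero]
  rfl

lemma fullOrbit_natCast (n : ℕ) : fullOrbit f z n = f^[n] z := by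
  induction n with
  | zero => exact fullOrbit_zero f
  | succ n ih => rw [Nat.cast_succ, isOrbit_fullOrbit, ih, iterate_succ_apply']

lemma fullOrbit_neg (n : ℤ) : fullOrbit f z (-n) = fullOrbit f.symm z n := by
  rw [fullOrbit, fullOrbit, zpow_neg, ← inv_zpow]
  rfl

lemma tendsto_fullOrbit_atTop (hz : z ∈ basin f p) :
    Tendsto (fullOrbit f z) atTop (𝓝 p) := by
  rw [← Nat.map_cast_int_atTop, tendsto_map'_iff]
  exact hz.congr fun n => (fullOrbit_natCast f n).symm

lemma tendsto_fullOrbit_atBot (hz : z ∈ basin f.symm p) :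
    Tendsto (fullOrbit f z) atBot (𝓝 p) :=
  ((tendsto_fullOrbit_atTop f.symm hz).comp tendsto_neg_atBot_atTop).congr fun n => by
    rw [comp_apply, ← fullOrbit_neg, neg_neg]

lemma mem_unstableSet_of_mem_basin_symm (hz : z ∈ basin f.symm p) : z ∈ unstableSet f p :=
  ⟨fullOrbit f z, isOrbit_fullOrbit f, fullOrbit_zero f, tendsto_fullOrbit_atBot f hz⟩

lemma image_basin : f '' basin f p = basin f p := by
  have hpre : f ⁻¹' basin f p = basin f p := Set.ext fun z => map_mem_basin_iff (f := f) (z := z)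
  conv_lhs => rw [← hpre]
  exact image_preimage_eq _ f.surjective

end FullOrbit

/-! ### The cooperative normal form -/

/-- The map `F a` in the coordinates `u = (x + y - π) / 2`, `v = (x - y + π) / 2`, for the
coefficients `b = 3 * a` and `c = a`. -/
def coopMap (b c : ℝ) (z : ℝ × ℝ) : ℝ × ℝ :=
  (z.1 + b * (cos z.1 * sin z.2), z.2 + c * (sin z.1 * cos z.2))

/-- The range of the coefficients in which `coopMap b c` is a homeomorphism of the plane that is
order preserving on `square`. -/
structure WeakCoupling (b c : ℝ) : Prop where
  b_pos : 0 < b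
  b_lt_one : b < 1
  c_pos : 0 < c
  c_lt_one : c < 1

/-- The square `[-π/2, π/2] × [-π/2, π/2]`; reflections in its sides carry the dynamics of
`coopMap` to the rest of the plane. -/
def square : Set (ℝ × ℝ) := Icc (-(π / 2)) (π / 2) ×ˢ Icc (-(π / 2)) (π / 2)

/-- The open second quadrant. -/
def upperLeft : Set (ℝ × ℝ) := Iio 0 ×ˢ Ioi 0

/-- The upper right vertex of `square`, a sink of `coopMap`; the other sink in `square` is
`-sinkPt`. -/
def sinkPt : ℝ × ℝ := (π / 2, π / 2)

/-- The upper left vertex of `square`. For `coopMap` it is a repeller, as is `-vertex`. -/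
def vertex : ℝ × ℝ := (-(π / 2), π / 2)

section Square

variable {z w : ℝ × ℝ}

lemma swap_mem_square (hz : z ∈ square) : z.swap ∈ square := ⟨hz.2, hz.1⟩

lemma neg_mem_square (hz : z ∈ square) : -z ∈ square :=
  ⟨⟨neg_le_neg hz.1.2, neg_le.1 hz.1.1⟩, neg_le_neg hz.2.2, neg_le.1 hz.2.1⟩

lemma zero_mem_square : (0 : ℝ × ℝ) ∈ square := by
  have h := pi_div_two_pos
  exact ⟨⟨neg_nonpos.2 h.le, h.le⟩, neg_nonpos.2 h.le, h.le⟩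

lemma vertex_mem_square : vertex ∈ square := by
  have h := neg_le_self pi_div_two_pos.le
  exact ⟨⟨le_rfl, h⟩, h, le_rfl⟩

lemma isCompact_square : IsCompact square := isCompact_Icc.prod isCompact_Icc

lemma isOpen_upperLeft : IsOpen upperLeft := isOpen_Iio.prod isOpen_Ioi

lemma neg_notMem_upperLeft (hz : z ∈ upperLeft) : -z ∉ upperLeft :=
  fun h => lt_asymm (mem_Iio.1 hz.1) (Left.neg_neg_iff.1 h.1)

lemma quadrant_cases (z : ℝ × ℝ) : 0 ≤ z ∨ z ≤ 0 ∨ z ∈ upperLeft ∨ -z ∈ upperLeft := by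
  simp only [Prod.le_def, upperLeft, mem_prod, mem_Iio, mem_Ioi, Prod.fst_neg, Prod.snd_neg,
    Prod.fst_zero, Prod.snd_zero]
  grind

lemma neg_sinkPt_ne_sinkPt : -sinkPt ≠ sinkPt := fun h =>
  (neg_lt_self pi_div_two_pos).ne (congrArg Prod.fst h)

end Square

section NormalForm

variable {b c : ℝ} {z w : ℝ × ℝ}

lemma continuous_coopMap : Continuous (coopMap b c) := by unfold coopMap; fun_prop

lemma semiconj_swap : Semiconj Prod.swap (coopMap b c) (coopMap c b) := fun z => by
  ext <;> simp [coopMap, mul_comm]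

lemma coopMap_neg (z : ℝ × ℝ) : coopMap b c (-z) = -coopMap b c z := by
  ext <;> simp [coopMap] <;> ring

lemma semiconj_neg : Semiconj Neg.neg (coopMap b c) (coopMap b c) := fun z => (coopMap_neg z).symm

lemma iterate_coopMap_neg (n : ℕ) (z : ℝ × ℝ) : (coopMap b c)^[n] (-z) = -(coopMap b c)^[n] z :=
  ((semiconj_neg.iterate_right n).eq z).symm

lemma isFixedPt_coopMap_zero : IsFixedPt (coopMap b c) 0 := by
  ext <;> simp [coopMap]

lemma neg_mem_basin_neg {p : ℝ × ℝ} (hz : z ∈ basin (coopMap b c) p) :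
    -z ∈ basin (coopMap b c) (-p) :=
  mem_basin_of_semiconj continuous_neg semiconj_neg hz

lemma swap_mem_basin_swap {p : ℝ × ℝ} (hz : z ∈ basin (coopMap b c) p) :
    z.swap ∈ basin (coopMap c b) p.swap :=
  mem_basin_of_semiconj continuous_swap semiconj_swap hz

lemma abs_cos_mul_sin_sub_le (z w : ℝ × ℝ) :
    |cos z.1 * sin z.2 - cos w.1 * sin w.2| ≤ ‖z - w‖ := by
  have h₁ := abs_le.1 (norm_fst_le (z - w))
  have h₂ := abs_le.1 (norm_snd_le (z - w))
  simp only [Prod.fst_sub, Prod.snd_sub] at h₁ h₂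
  have hdiff : |(z.2 - z.1) - (w.2 - w.1)| + |(z.2 + z.1) - (w.2 + w.1)| ≤ 2 * ‖z - w‖ := by
    rcases abs_cases ((z.2 - z.1) - (w.2 - w.1)) with h | h <;>
      rcases abs_cases ((z.2 + z.1) - (w.2 + w.1)) with h' | h' <;> linarith
  have hprod : 2 * (cos z.1 * sin z.2 - cos w.1 * sin w.2) =
      (sin (z.2 - z.1) - sin (w.2 - w.1)) + (sin (z.2 + z.1) - sin (w.2 + w.1)) := by
    linear_combination two_mul_sin_mul_cos z.2 z.1 - two_mul_sin_mul_cos w.2 w.1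
  have hsin := (abs_add_le _ _).trans (add_le_add
    (abs_sin_sub_sin_le (z.2 - z.1) (w.2 - w.1)) (abs_sin_sub_sin_le (z.2 + z.1) (w.2 + w.1)))
  rw [← hprod, abs_mul, abs_two] at hsin
  linarith

lemma norm_coopMap_sub_sub_le (z w : ℝ × ℝ) :
    ‖coopMap b c z - coopMap b c w - (z - w)‖ ≤ max |b| |c| * ‖z - w‖ := by
  have hz := abs_cos_mul_sin_sub_le z w
  have hz' : |cos z.2 * sin z.1 - cos w.2 * sin w.1| ≤ ‖z - w‖ := by
    have := abs_cos_mul_sin_sub_le z.swap w.swap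
    rwa [← Prod.swap_sub, Prod.norm_def, max_comm] at this
  refine max_le ?_ ?_
  · calc |_| = |b| * |cos z.1 * sin z.2 - cos w.1 * sin w.2| := by
          rw [← abs_mul]; congr 1; simp only [coopMap, Prod.fst_sub]; ring
      _ ≤ max |b| |c| * ‖z - w‖ := by gcongr; exact le_max_left _ _
  · calc |_| = |c| * |cos z.2 * sin z.1 - cos w.2 * sin w.1| := by
          rw [← abs_mul]; congr 1; simp only [coopMap, Prod.snd_sub]; ring
      _ ≤ max |b| |c| * ‖z - w‖ := by gcongr; exact le_max_right _ _

lemma approximatesLinearOn_coopMap : ApproximatesLinearOn (coopMap b c)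
    (ContinuousLinearEquiv.refl ℝ (ℝ × ℝ) : ℝ × ℝ →L[ℝ] ℝ × ℝ) univ (max ‖b‖₊ ‖c‖₊) :=
  fun z _ w _ => norm_coopMap_sub_sub_le z w

lemma abs_fst_coopMap_sub_le (hb : |b| ≤ 1) (z : ℝ × ℝ) : |(coopMap b c z).1 - z.1| ≤ |z.2| := by
  calc |(coopMap b c z).1 - z.1| = |b| * (|cos z.1| * |sin z.2|) := by
        rw [← abs_mul, ← abs_mul]; congr 1; simp only [coopMap]; ring
    _ ≤ 1 * (1 * |z.2|) := by gcongr ?_ * (?_ * ?_); exacts [abs_cos_le_one _, abs_sin_le_abs]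
    _ = |z.2| := by ring

end NormalForm

namespace WeakCoupling

variable {b c : ℝ} {z w p : ℝ × ℝ} (h : WeakCoupling b c)

include h

lemma swap : WeakCoupling c b := ⟨h.c_pos, h.c_lt_one, h.b_pos, h.b_lt_one⟩

lemma max_abs_lt_one : max |b| |c| < 1 := by
  rw [abs_of_pos h.b_pos, abs_of_pos h.c_pos]
  exact max_lt h.b_lt_one h.c_lt_one

lemma strictMono_fst (v : ℝ) : StrictMono fun u => (coopMap b c (u, v)).1 := fun x y hxy => by
  have hdisp := (abs_le.1 ((norm_fst_le _).trans
    (norm_coopMap_sub_sub_le (b := b) (c := c) (y, v) (x, v)))).1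
  have hnorm : ‖((y, v) - (x, v) : ℝ × ℝ)‖ = y - x := by
    simp [Prod.norm_def, abs_of_pos, hxy, hxy.le]
  rw [hnorm] at hdisp
  have hlt := mul_lt_mul_of_pos_right h.max_abs_lt_one (sub_pos.2 hxy)
  simp only [Prod.fst_sub] at hdisp ⊢
  linarith

lemma strictMono_snd (u : ℝ) : StrictMono fun v => (coopMap b c (u, v)).2 := fun x y hxy => by
  have := h.swap.strictMono_fst u hxy
  simpa only [← Prod.swap_prod_mk (a := u), ← semiconj_swap.eq, Prod.fst_swap] using this

lemma fst_le_iff {k : ℝ} (hk : cos k = 0) (z : ℝ × ℝ) : (coopMap b c z).1 ≤ k ↔ z.1 ≤ k := by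
  simpa [coopMap, hk] using (h.strictMono_fst z.2).le_iff_le (a := z.1) (b := k)

lemma le_fst_iff {k : ℝ} (hk : cos k = 0) (z : ℝ × ℝ) : k ≤ (coopMap b c z).1 ↔ k ≤ z.1 := by
  simpa [coopMap, hk] using (h.strictMono_fst z.2).le_iff_le (a := k) (b := z.1)

lemma snd_le_iff {k : ℝ} (hk : cos k = 0) (z : ℝ × ℝ) : (coopMap b c z).2 ≤ k ↔ z.2 ≤ k := by
  simpa [coopMap, hk] using (h.strictMono_snd z.1).le_iff_le (a := z.2) (b := k)

lemma le_snd_iff {k : ℝ} (hk : cos k = 0) (z : ℝ × ℝ) : k ≤ (coopMap b c z).2 ↔ k ≤ z.2 := by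
  simpa [coopMap, hk] using (h.strictMono_snd z.1).le_iff_le (a := k) (b := z.2)

lemma coopMap_mem_square_iff : coopMap b c z ∈ square ↔ z ∈ square := by
  have hneg : cos (-(π / 2)) = 0 := by simp
  simp only [square, mem_prod, mem_Icc, h.fst_le_iff cos_pi_div_two, h.le_fst_iff hneg,
    h.snd_le_iff cos_pi_div_two, h.le_snd_iff hneg]

lemma iterate_mem_square_iff (n : ℕ) : (coopMap b c)^[n] z ∈ square ↔ z ∈ square := by
  induction n with
  | zero => rfl
  | succ n ih => rw [iterate_succ_apply', h.coopMap_mem_square_iff, ih]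

lemma fst_coopMap_le (hz : z ∈ square) (hw : w ∈ square) (hzw : z ≤ w) :
    (coopMap b c z).1 ≤ (coopMap b c w).1 := by
  have hcos : 0 ≤ cos w.1 := cos_nonneg_of_mem_Icc hw.1
  have hsin : sin z.2 ≤ sin w.2 := sin_le_sin_of_le_of_le_pi_div_two hz.2.1 hw.2.2 hzw.2
  have hb := h.b_pos
  calc (coopMap b c z).1 ≤ (coopMap b c (w.1, z.2)).1 := (h.strictMono_fst z.2).monotone hzw.1
    _ ≤ (coopMap b c w).1 := by simp only [coopMap]; gcongr

lemma coopMap_le_coopMap (hz : z ∈ square) (hw : w ∈ square) (hzw : z ≤ w) :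
    coopMap b c z ≤ coopMap b c w := by
  refine ⟨h.fst_coopMap_le hz hw hzw, ?_⟩
  have := h.swap.fst_coopMap_le (swap_mem_square hz) (swap_mem_square hw) (Prod.swap_le_swap.2 hzw)
  rwa [← semiconj_swap.eq, ← semiconj_swap.eq] at this

lemma iterate_coopMap_le (hz : z ∈ square) (hw : w ∈ square) (hzw : z ≤ w) (n : ℕ) :
    (coopMap b c)^[n] z ≤ (coopMap b c)^[n] w := by
  induction n with
  | zero => exact hzw
  | succ n ih =>
    rw [iterate_succ_apply', iterate_succ_apply']
    exact h.coopMap_le_coopMap ((h.iterate_mem_square_iff n).2 hz)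
      ((h.iterate_mem_square_iff n).2 hw) ih

lemma coopMap_nonneg (hz : z ∈ square) (h0 : 0 ≤ z) : 0 ≤ coopMap b c z := by
  simpa only [isFixedPt_coopMap_zero.eq] using h.coopMap_le_coopMap zero_mem_square hz h0

lemma coopMap_nonpos (hz : z ∈ square) (h0 : z ≤ 0) : coopMap b c z ≤ 0 := by
  simpa only [isFixedPt_coopMap_zero.eq] using h.coopMap_le_coopMap hz zero_mem_square h0

lemma le_fst_coopMap (hz : z ∈ square) (h₂ : 0 ≤ z.2) : z.1 ≤ (coopMap b c z).1 := by
  have hcos : 0 ≤ cos z.1 := cos_nonneg_of_mem_Icc hz.1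
  have hsin : 0 ≤ sin z.2 := sin_nonneg_of_nonneg_of_le_pi h₂ (hz.2.2.trans (by linarith [pi_pos]))
  exact le_add_of_nonneg_right (mul_nonneg h.b_pos.le (mul_nonneg hcos hsin))

lemma le_snd_coopMap (hz : z ∈ square) (h₁ : 0 ≤ z.1) : z.2 ≤ (coopMap b c z).2 := by
  simpa [← semiconj_swap.eq] using h.swap.le_fst_coopMap (swap_mem_square hz) h₁

lemma snd_coopMap_le (hz : z ∈ square) (h₁ : z.1 ≤ 0) : (coopMap b c z).2 ≤ z.2 := by
  simpa [coopMap_neg] using h.le_snd_coopMap (neg_mem_square hz) (neg_nonneg.2 h₁)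

lemma isFixedPt_cases (hz : z ∈ square) (hf : IsFixedPt (coopMap b c) z) :
    z = 0 ∨ (z.1 = π / 2 ∨ z.1 = -(π / 2)) ∧ (z.2 = π / 2 ∨ z.2 = -(π / 2)) := by
  have hfst : cos z.1 * sin z.2 = 0 := by
    simpa [coopMap, h.b_pos.ne'] using congrArg Prod.fst hf.eq
  have hsnd : sin z.1 * cos z.2 = 0 := by
    simpa [coopMap, h.c_pos.ne'] using congrArg Prod.snd hf.eq
  have endpoint {x : ℝ} (hx : x ∈ Icc (-(π / 2)) (π / 2)) (hcos : cos x = 0) :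
      x = π / 2 ∨ x = -(π / 2) := by
    by_contra! hne
    exact (cos_pos_of_mem_Ioo ⟨hx.1.lt_of_ne' hne.2, hx.2.lt_of_ne hne.1⟩).ne' hcos
  have center {x : ℝ} (hx : x ∈ Icc (-(π / 2)) (π / 2)) (hsin : sin x = 0) : x = 0 :=
    (sin_eq_zero_iff_of_lt_of_lt (by linarith [hx.1, pi_pos]) (by linarith [hx.2, pi_pos])).1 hsin
  have not_both (x : ℝ) (hsin : sin x = 0) (hcos : cos x = 0) : False := by
    simpa [hsin, hcos] using sin_sq_add_cos_sq x
  rcases mul_eq_zero.1 hfst with h₁ | h₁ <;> rcases mul_eq_zero.1 hsnd with h₂ | h₂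
  · exact (not_both _ h₂ h₁).elim
  · exact .inr ⟨endpoint hz.1 h₁, endpoint hz.2 h₂⟩
  · exact .inl (Prod.ext (center hz.1 h₂) (center hz.2 h₁))
  · exact (not_both _ h₁ h₂).elim

lemma mem_upperLeft_of_coopMap_mem (hz : z ∈ square) (hK : coopMap b c z ∈ upperLeft) :
    z ∈ upperLeft := by
  rcases quadrant_cases z with h0 | h0 | hul | hlr
  · exact absurd hK.1 (h.coopMap_nonneg hz h0).1.not_gt
  · exact absurd hK.2 (h.coopMap_nonpos hz h0).2.not_gt
  · exact hul
  · have hz₁ : 0 < z.1 := neg_lt_zero.1 hlr.1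
    have hz₂ : z.2 < 0 := neg_pos.1 hlr.2
    -- The displacement of each coordinate is at most the size of the other one, so at most one
    -- of them can change sign.
    have h₁ : z.1 < -z.2 := by
      have := abs_fst_coopMap_sub_le (c := c) ((abs_of_pos h.b_pos).trans_le h.b_lt_one.le) z
      rw [abs_of_neg hz₂] at this
      linarith [(abs_le.1 this).1, mem_Iio.1 hK.1]
    have h₂ : -z.2 < z.1 := by
      have := abs_fst_coopMap_sub_le (c := b) ((abs_of_pos h.c_pos).trans_le h.c_lt_one.le) z.swap
      rw [← semiconj_swap.eq, Prod.fst_swap, Prod.fst_swap, Prod.snd_swap,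
        abs_of_pos hz₁] at this
      linarith [(abs_le.1 this).2, mem_Ioi.1 hK.2]
    exact absurd h₁ h₂.not_gt

/-- `coopMap b c` as a homeomorphism of the plane. -/
def homeo : ℝ × ℝ ≃ₜ ℝ × ℝ :=
  (approximatesLinearOn_coopMap (b := b) (c := c)).toHomeomorph _ <| .inr <| by
    have : ‖(ContinuousLinearMap.id ℝ (ℝ × ℝ))‖₊ = 1 := NNReal.eq ContinuousLinearMap.norm_id
    rw [ContinuousLinearEquiv.refl_symm, ContinuousLinearEquiv.coe_refl, this, inv_one]
    exact h.max_abs_lt_one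

end WeakCoupling

/-! ### The separatrix -/

/-- The stable set of the origin, continued along the antidiagonal from the two vertices of
`square` that it joins, so as to cut the whole plane in two. -/
def separatrix (b c : ℝ) : Set (ℝ × ℝ) :=
  basin (coopMap b c) 0 ∪ {z | z.1 + z.2 = 0 ∧ π / 2 ≤ |z.1|}

section Separatrix

variable {b c : ℝ} {z : ℝ × ℝ}

lemma neg_mem_separatrix (hz : z ∈ separatrix b c) : -z ∈ separatrix b c := by
  refine hz.imp (fun h => ?_) fun h => ⟨?_, ?_⟩
  · simpa using neg_mem_basin_neg h
  · simpa [add_comm] using congrArg Neg.neg h.1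
  · simpa using h.2

lemma swap_mem_separatrix (hz : z ∈ separatrix b c) : z.swap ∈ separatrix c b := by
  refine hz.imp swap_mem_basin_swap fun h => ⟨(add_comm _ _).trans h.1, ?_⟩
  rw [Prod.fst_swap, eq_neg_of_add_eq_zero_right h.1, abs_neg]
  exact h.2

lemma vertex_mem_separatrix : vertex ∈ separatrix b c :=
  .inr ⟨neg_add_cancel _, by simp [vertex, abs_of_pos pi_div_two_pos]⟩

lemma eventually_displacement_sum_le (hb : 0 < b) (hc : 0 < c) :
    ∀ᶠ q : (ℝ × ℝ) × (ℝ × ℝ) in 𝓝 (0, 0), q.2 ≤ q.1 →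
      b * (cos q.2.1 * sin q.2.2) + c * (sin q.2.1 * cos q.2.2) ≤
        b * (cos q.1.1 * sin q.1.2) + c * (sin q.1.1 * cos q.1.2) := by
  have hderiv : HasStrictFDerivAt
      (fun z : ℝ × ℝ => b * (cos z.1 * sin z.2) + c * (sin z.1 * cos z.2))
      (b • ContinuousLinearMap.snd ℝ ℝ ℝ + c • ContinuousLinearMap.fst ℝ ℝ ℝ) (0 : ℝ × ℝ) := by
    have h₁ := hasStrictFDerivAt_fst (𝕜 := ℝ) (p := (0 : ℝ × ℝ))
    have h₂ := hasStrictFDerivAt_snd (𝕜 := ℝ) (p := (0 : ℝ × ℝ))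
    simpa using ((h₁.cos.mul h₂.sin).const_mul b).fun_add ((h₁.sin.mul h₂.cos).const_mul c)
  filter_upwards [hderiv.isLittleO.def (lt_min hb hc)] with q hq hle
  have h₁ : 0 ≤ q.1.1 - q.2.1 := sub_nonneg.2 hle.1
  have h₂ : 0 ≤ q.1.2 - q.2.2 := sub_nonneg.2 hle.2
  have hnorm : ‖q.1 - q.2‖ ≤ (q.1.1 - q.2.1) + (q.1.2 - q.2.2) := by
    simp only [Prod.norm_def, Prod.fst_sub, Prod.snd_sub, norm_of_nonneg h₁, norm_of_nonneg h₂]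
    exact max_le_add_of_nonneg h₁ h₂
  have hmin : min b c * ‖q.1 - q.2‖ ≤ c * (q.1.1 - q.2.1) + b * (q.1.2 - q.2.2) := by
    calc min b c * ‖q.1 - q.2‖ ≤ min b c * ((q.1.1 - q.2.1) + (q.1.2 - q.2.2)) := by gcongr
      _ ≤ c * (q.1.1 - q.2.1) + b * (q.1.2 - q.2.2) := by
          rw [mul_add]; gcongr; exacts [min_le_right _ _, min_le_left _ _]
  have := neg_le_of_abs_le (hq.trans hmin)
  simp at this
  linarith

end Separatrix

namespace WeakCoupling

variable {b c : ℝ} {z w p : ℝ × ℝ} (h : WeakCoupling b c)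

include h

lemma fst_lt_of_mem_basin {k : ℝ} (hk : cos k = 0) (hz : z ∈ basin (coopMap b c) p)
    (hp : p.1 < k) : z.1 < k :=
  mem_of_mem_basin (S := {z | z.1 < k}) hz (continuous_fst.continuousAt.eventually_lt_const hp)
    fun w hw => lt_of_not_ge fun hkw => hw.not_ge ((h.le_fst_iff hk w).2 hkw)

lemma snd_lt_of_mem_basin {k : ℝ} (hk : cos k = 0) (hz : z ∈ basin (coopMap b c) p)
    (hp : p.2 < k) : z.2 < k :=
  h.swap.fst_lt_of_mem_basin hk (swap_mem_basin_swap hz) hp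

lemma lt_fst_of_mem_basin {k : ℝ} (hk : cos k = 0) (hz : z ∈ basin (coopMap b c) p)
    (hp : k < p.1) : k < z.1 :=
  neg_lt_neg_iff.1 <| h.fst_lt_of_mem_basin ((cos_neg k).trans hk) (neg_mem_basin_neg hz)
    (neg_lt_neg hp)

lemma lt_snd_of_mem_basin {k : ℝ} (hk : cos k = 0) (hz : z ∈ basin (coopMap b c) p)
    (hp : k < p.2) : k < z.2 :=
  h.swap.lt_fst_of_mem_basin hk (swap_mem_basin_swap hz) hp

lemma mem_Ioo_of_mem_basin_zero (hz : z ∈ basin (coopMap b c) 0) :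
    z.1 ∈ Ioo (-(π / 2)) (π / 2) ∧ z.2 ∈ Ioo (-(π / 2)) (π / 2) := by
  have hneg : cos (-(π / 2)) = 0 := by simp
  have hpos := pi_div_two_pos
  exact ⟨⟨h.lt_fst_of_mem_basin hneg hz (neg_lt_zero.2 hpos),
      h.fst_lt_of_mem_basin cos_pi_div_two hz hpos⟩,
    h.lt_snd_of_mem_basin hneg hz (neg_lt_zero.2 hpos),
      h.snd_lt_of_mem_basin cos_pi_div_two hz hpos⟩

lemma mem_square_of_mem_basin_zero (hz : z ∈ basin (coopMap b c) 0) : z ∈ square :=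
  (h.mem_Ioo_of_mem_basin_zero hz).imp (Ioo_subset_Icc_self ·) (Ioo_subset_Icc_self ·)

lemma mem_basin_sinkPt_of_nonneg (hz : z ∈ square) (h0 : 0 ≤ z) (hne : z ≠ 0) :
    z ∈ basin (coopMap b c) sinkPt := by
  have hsq n : (coopMap b c)^[n] z ∈ square := (h.iterate_mem_square_iff n).2 hz
  have hnonneg n : 0 ≤ (coopMap b c)^[n] z := by
    simpa only [(isFixedPt_coopMap_zero.iterate n).eq] using
      h.iterate_coopMap_le zero_mem_square hz h0 n
  have hfst : Monotone fun n => ((coopMap b c)^[n] z).1 := monotone_nat_of_le_succ fun n => by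
    rw [iterate_succ_apply']; exact h.le_fst_coopMap (hsq n) (hnonneg n).2
  have hsnd : Monotone fun n => ((coopMap b c)^[n] z).2 := monotone_nat_of_le_succ fun n => by
    rw [iterate_succ_apply']; exact h.le_snd_coopMap (hsq n) (hnonneg n).1
  obtain ⟨y, hy, hfix, hlim⟩ := exists_isFixedPt_mem_basin continuous_coopMap isCompact_square hsq
    (.inl hfst) (.inl hsnd)
  have hzy : z ≤ y := ⟨hfst.ge_of_tendsto hlim.fst_nhds 0, hsnd.ge_of_tendsto hlim.snd_nhds 0⟩
  rcases h.isFixedPt_cases hy hfix with rfl | ⟨h₁, h₂⟩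
  · exact absurd (le_antisymm hzy h0) hne
  · have hneg : ¬ 0 ≤ -(π / 2) := not_le.2 (neg_lt_zero.2 pi_div_two_pos)
    have h₁ := h₁.resolve_right fun e => hneg (e ▸ (h0.trans hzy).1)
    have h₂ := h₂.resolve_right fun e => hneg (e ▸ (h0.trans hzy).2)
    rwa [show sinkPt = y from Prod.ext h₁.symm h₂.symm]

lemma mem_basin_neg_sinkPt_of_nonpos (hz : z ∈ square) (h0 : z ≤ 0) (hne : z ≠ 0) :
    z ∈ basin (coopMap b c) (-sinkPt) := by
  simpa using neg_mem_basin_neg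
    (h.mem_basin_sinkPt_of_nonneg (neg_mem_square hz) (neg_nonneg.2 h0) (neg_ne_zero.2 hne))

lemma mem_basin_sinkPt_iff_exists (hz : z ∈ square) :
    z ∈ basin (coopMap b c) sinkPt ↔ ∃ n, (coopMap b c)^[n] z ∈ Ioi 0 ×ˢ Ioi 0 := by
  refine ⟨fun hlim => exists_iterate_mem_of_mem_basin hlim
    (prod_mem_nhds (Ioi_mem_nhds pi_div_two_pos) (Ioi_mem_nhds pi_div_two_pos)), ?_⟩
  rintro ⟨n, hn⟩
  refine (iterate_mem_basin_iff n).1 (h.mem_basin_sinkPt_of_nonneg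
    ((h.iterate_mem_square_iff n).2 hz) ⟨le_of_lt hn.1, le_of_lt hn.2⟩ fun h0 => ?_)
  exact lt_irrefl (0 : ℝ) (by simpa [h0] using hn.1)

lemma mem_basin_neg_sinkPt_iff_exists (hz : z ∈ square) :
    z ∈ basin (coopMap b c) (-sinkPt) ↔ ∃ n, (coopMap b c)^[n] z ∈ Iio 0 ×ˢ Iio 0 := by
  have hneg : z ∈ basin (coopMap b c) (-sinkPt) ↔ -z ∈ basin (coopMap b c) sinkPt :=
    ⟨fun hz => by simpa using neg_mem_basin_neg hz, fun hz => by simpa using neg_mem_basin_neg hz⟩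
  rw [hneg, h.mem_basin_sinkPt_iff_exists (neg_mem_square hz)]
  simp [iterate_coopMap_neg]

lemma mem_basin_neg_sinkPt_of_le (hz : z ∈ square) (hw : w ∈ square) (hzw : z ≤ w)
    (hwb : w ∈ basin (coopMap b c) (-sinkPt)) : z ∈ basin (coopMap b c) (-sinkPt) := by
  obtain ⟨n, hn⟩ := (h.mem_basin_neg_sinkPt_iff_exists hw).1 hwb
  have hle := h.iterate_coopMap_le hz hw hzw n
  exact (h.mem_basin_neg_sinkPt_iff_exists hz).2 ⟨n, hle.1.trans_lt hn.1, hle.2.trans_lt hn.2⟩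

lemma mem_separatrix_of_forall_mem_upperLeft (hz : z ∈ square)
    (hul : ∀ n, (coopMap b c)^[n] z ∈ upperLeft) : z ∈ separatrix b c := by
  have hsq n : (coopMap b c)^[n] z ∈ square := (h.iterate_mem_square_iff n).2 hz
  have hfst : Monotone fun n => ((coopMap b c)^[n] z).1 := monotone_nat_of_le_succ fun n => by
    rw [iterate_succ_apply']; exact h.le_fst_coopMap (hsq n) (le_of_lt (hul n).2)
  have hsnd : Antitone fun n => ((coopMap b c)^[n] z).2 := antitone_nat_of_succ_le fun n => by
    rw [iterate_succ_apply']; exact h.snd_coopMap_le (hsq n) (le_of_lt (hul n).1)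
  obtain ⟨y, hy, hfix, hlim⟩ := exists_isFixedPt_mem_basin continuous_coopMap isCompact_square hsq
    (.inl hfst) (.inr hsnd)
  rcases h.isFixedPt_cases hy hfix with rfl | ⟨h₁, h₂⟩
  · exact .inl hlim
  · have hpos := pi_div_two_pos
    have hy₁ : y.1 ≤ 0 := le_of_tendsto' hlim.fst_nhds fun n => le_of_lt (hul n).1
    have hy₂ : 0 ≤ y.2 := ge_of_tendsto' hlim.snd_nhds fun n => le_of_lt (hul n).2
    have hzy₁ : z.1 ≤ y.1 := hfst.ge_of_tendsto hlim.fst_nhds 0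
    have hzy₂ : y.2 ≤ z.2 := hsnd.le_of_tendsto hlim.snd_nhds 0
    have hvertex : z = vertex :=
      Prod.ext (hzy₁.trans_eq (h₁.resolve_left fun e => by linarith) |>.antisymm hz.1.1)
        (hz.2.2.antisymm ((h₂.resolve_right fun e => by linarith).symm.trans_le hzy₂))
    exact hvertex ▸ vertex_mem_separatrix

lemma mem_separatrix_of_mem_upperLeft (hz : z ∈ square) (hul : z ∈ upperLeft)
    (hn : ∀ n, ¬ 0 ≤ (coopMap b c)^[n] z ∧ ¬ (coopMap b c)^[n] z ≤ 0) : z ∈ separatrix b c := by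
  refine h.mem_separatrix_of_forall_mem_upperLeft hz fun n => ?_
  induction n with
  | zero => exact hul
  | succ n ih =>
    rcases quadrant_cases ((coopMap b c)^[n + 1] z) with h0 | h0 | h0 | h0
    · exact absurd h0 (hn _).1
    · exact absurd h0 (hn _).2
    · exact h0
    · rw [iterate_succ_apply', ← coopMap_neg] at h0
      exact absurd (h.mem_upperLeft_of_coopMap_mem
        (neg_mem_square ((h.iterate_mem_square_iff n).2 hz)) h0) (neg_notMem_upperLeft ih)

lemma basin_cases (hz : z ∈ square) :
    z ∈ basin (coopMap b c) sinkPt ∨ z ∈ basin (coopMap b c) (-sinkPt) ∨ z ∈ separatrix b c := by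
  have hsq n : (coopMap b c)^[n] z ∈ square := (h.iterate_mem_square_iff n).2 hz
  by_cases hzero : ∃ n, (coopMap b c)^[n] z = 0
  · obtain ⟨n, hn⟩ := hzero
    have hbasin := self_mem_basin (isFixedPt_coopMap_zero (b := b) (c := c))
    exact .inr (.inr (.inl ((iterate_mem_basin_iff n).1 (by rwa [hn]))))
  by_cases hsign : ∃ n, 0 ≤ (coopMap b c)^[n] z ∨ (coopMap b c)^[n] z ≤ 0
  · obtain ⟨n, hn⟩ := hsign
    have hne : (coopMap b c)^[n] z ≠ 0 := fun h0 => hzero ⟨n, h0⟩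
    rw [← iterate_mem_basin_iff n, ← iterate_mem_basin_iff (p := -sinkPt) n, ← or_assoc]
    exact .inl (hn.imp (h.mem_basin_sinkPt_of_nonneg (hsq n) · hne)
      (h.mem_basin_neg_sinkPt_of_nonpos (hsq n) · hne))
  · push Not at hsign
    refine .inr (.inr ?_)
    rcases quadrant_cases z with h0 | h0 | hul | hul
    · exact absurd h0 (hsign 0).1
    · exact absurd h0 (hsign 0).2
    · exact h.mem_separatrix_of_mem_upperLeft hz hul hsign
    · refine neg_neg z ▸ neg_mem_separatrix
        (h.mem_separatrix_of_mem_upperLeft (neg_mem_square hz) hul fun n => ?_)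
      rw [iterate_coopMap_neg, neg_nonneg, neg_nonpos]
      exact (hsign n).symm

lemma eq_of_le_of_mem_basin_zero (hz : z ∈ basin (coopMap b c) 0) (hw : w ∈ basin (coopMap b c) 0)
    (hzw : z ≤ w) : z = w := by
  by_contra hne
  have hle := h.iterate_coopMap_le (h.mem_square_of_mem_basin_zero hz)
    (h.mem_square_of_mem_basin_zero hw) hzw
  -- The sum of the coordinates of `w_n - z_n` is positive and tends to `0`, but does not
  -- decrease once both orbits are close to the origin.
  let d (n : ℕ) : ℝ := (((coopMap b c)^[n] w).1 + ((coopMap b c)^[n] w).2) -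
    (((coopMap b c)^[n] z).1 + ((coopMap b c)^[n] z).2)
  have hlim : Tendsto d atTop (𝓝 0) := by
    simpa using (hw.fst_nhds.add hw.snd_nhds).sub (hz.fst_nhds.add hz.snd_nhds)
  obtain ⟨N, hN⟩ := eventually_atTop.1
    ((hw.prodMk_nhds hz).eventually (eventually_displacement_sum_le h.b_pos h.c_pos))
  have hmono : Monotone fun n => d (n + N) := monotone_add_nat_of_le_succ fun n hn => by
    have := hN n hn (hle n)
    simp only [d, iterate_succ_apply', coopMap] at this ⊢
    linarith
  have hd : d N ≤ 0 := by
    simpa using hmono.ge_of_tendsto ((tendsto_add_atTop_iff_nat N).2 hlim) 0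
  have h₁ := (hle N).1
  have h₂ := (hle N).2
  exact hne (h.homeo.injective.iterate N (Prod.ext (h₁.antisymm (by linarith))
    (h₂.antisymm (by linarith))))

lemma eq_of_le_of_mem_separatrix (hz : z ∈ separatrix b c) (hw : w ∈ separatrix b c)
    (hzw : z ≤ w) : z = w := by
  have not_le {z w : ℝ × ℝ} (hz : z ∈ basin (coopMap b c) 0) (hw : w.1 + w.2 = 0)
      (hw' : π / 2 ≤ |w.1|) : ¬ z ≤ w := fun hzw => by
    have hIoo := h.mem_Ioo_of_mem_basin_zero hz
    rcases le_abs.1 hw' with hw' | hw' <;> linarith [hzw.1, hzw.2, hIoo.1.1, hIoo.2.1]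
  rcases hz with hz | hz <;> rcases hw with hw | hw
  · exact h.eq_of_le_of_mem_basin_zero hz hw hzw
  · exact absurd hzw (not_le hz hw.1 hw.2)
  · have := neg_mem_basin_neg hw
    rw [neg_zero] at this
    refine absurd (neg_le_neg hzw) (not_le this ?_ ?_)
    · simpa [add_comm] using congrArg Neg.neg hz.1
    · simpa using hz.2
  · exact Prod.ext (hzw.1.antisymm (by linarith [hzw.2, hz.1, hw.1]))
      (hzw.2.antisymm (by linarith [hzw.1, hz.1, hw.1]))

lemma notMem_basin_neg_sinkPt_of_mem_separatrix (hz : z ∈ separatrix b c) :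
    z ∉ basin (coopMap b c) (-sinkPt) := by
  have hpos := pi_div_two_pos
  intro hbot
  rcases hz with hz | ⟨hsum, habs⟩
  · exact (neg_lt_zero.2 hpos).ne (congrArg Prod.fst (eq_of_mem_basin hbot hz))
  · have h₁ := h.fst_lt_of_mem_basin cos_pi_div_two hbot (neg_lt_self hpos)
    have h₂ := h.snd_lt_of_mem_basin cos_pi_div_two hbot (neg_lt_self hpos)
    rcases le_abs.1 habs with habs | habs <;> linarith

lemma notMem_basin_sinkPt_of_mem_separatrix (hz : z ∈ separatrix b c) :
    z ∉ basin (coopMap b c) sinkPt := fun htop =>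
  h.notMem_basin_neg_sinkPt_of_mem_separatrix (neg_mem_separatrix hz) (neg_mem_basin_neg htop)

lemma mem_basin_sinkPt_of_lt (hz : z ∈ separatrix b c) (hw : w ∈ square) (hzw : z < w) :
    w ∈ basin (coopMap b c) sinkPt := by
  rcases h.basin_cases hw with htop | hbot | hsep
  · exact htop
  · exfalso
    rcases id hz with hz' | ⟨hsum, habs⟩
    · exact h.notMem_basin_neg_sinkPt_of_mem_separatrix hz
        (h.mem_basin_neg_sinkPt_of_le (h.mem_square_of_mem_basin_zero hz') hw hzw.le hbot)
    · have hpos := pi_div_two_pos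
      have h₁ := h.fst_lt_of_mem_basin cos_pi_div_two hbot (neg_lt_self hpos)
      have h₂ := h.snd_lt_of_mem_basin cos_pi_div_two hbot (neg_lt_self hpos)
      rcases le_abs.1 habs with habs | habs <;> linarith [hzw.le.1, hzw.le.2]
  · exact absurd (h.eq_of_le_of_mem_separatrix hz hsep hzw.le) hzw.ne

lemma mem_basin_neg_sinkPt_of_lt (hz : z ∈ separatrix b c) (hw : w ∈ square) (hwz : w < z) :
    w ∈ basin (coopMap b c) (-sinkPt) := by
  simpa using neg_mem_basin_neg
    (h.mem_basin_sinkPt_of_lt (neg_mem_separatrix hz) (neg_mem_square hw) (neg_lt_neg hwz))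

lemma exists_mem_separatrix_of_isPreconnected {s : Set (ℝ × ℝ)} (hs : IsPreconnected s)
    (hsq : s ⊆ square) (htop : ∃ z ∈ s, z ∈ basin (coopMap b c) sinkPt)
    (hbot : ∃ z ∈ s, z ∈ basin (coopMap b c) (-sinkPt)) : ∃ z ∈ s, z ∈ separatrix b c := by
  obtain ⟨z, hz, hn⟩ := exists_forall_iterate_notMem (continuous_coopMap (b := b) (c := c)) hs
    (isOpen_Ioi.prod isOpen_Ioi) (isOpen_Iio.prod isOpen_Iio)
    (htop.imp fun z hz => ⟨hz.1, (h.mem_basin_sinkPt_iff_exists (hsq hz.1)).1 hz.2⟩)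
    (hbot.imp fun z hz => ⟨hz.1, (h.mem_basin_neg_sinkPt_iff_exists (hsq hz.1)).1 hz.2⟩)
    fun z hz m n hm hn => neg_sinkPt_ne_sinkPt (eq_of_mem_basin
      ((h.mem_basin_neg_sinkPt_iff_exists (hsq hz)).2 ⟨n, hn⟩)
      ((h.mem_basin_sinkPt_iff_exists (hsq hz)).2 ⟨m, hm⟩))
  refine ⟨z, hz, ((h.basin_cases (hsq hz)).resolve_left fun h' => ?_).resolve_left fun h' => ?_⟩
  · obtain ⟨n, hn'⟩ := (h.mem_basin_sinkPt_iff_exists (hsq hz)).1 h'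
    exact (hn n).1 hn'
  · obtain ⟨n, hn'⟩ := (h.mem_basin_neg_sinkPt_iff_exists (hsq hz)).1 h'
    exact (hn n).2 hn'

lemma exists_mem_separatrix (u : ℝ) : ∃ v, (u, v) ∈ separatrix b c := by
  rcases le_or_gt (π / 2) |u| with hu | hu
  · exact ⟨-u, .inr ⟨add_neg_cancel u, hu⟩⟩
  obtain ⟨hu₁, hu₂⟩ := abs_lt.1 hu
  have hsq : {u} ×ˢ Icc (-(π / 2)) (π / 2) ⊆ square :=
    prod_mono_left (singleton_subset_iff.2 ⟨hu₁.le, hu₂.le⟩)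
  have hmax : (u, π / 2) ∈ {u} ×ˢ Icc (-(π / 2)) (π / 2) := ⟨rfl, vertex_mem_square.2⟩
  have hmin : (u, -(π / 2)) ∈ {u} ×ˢ Icc (-(π / 2)) (π / 2) := ⟨rfl, vertex_mem_square.1⟩
  have htop := h.mem_basin_sinkPt_of_lt vertex_mem_separatrix (hsq hmax)
    (Prod.mk_lt_mk_of_lt_of_le hu₁ le_rfl)
  have hbot := h.mem_basin_neg_sinkPt_of_lt (neg_mem_separatrix vertex_mem_separatrix) (hsq hmin)
    (Prod.mk_lt_mk_of_lt_of_le (hu₂.trans_eq (neg_neg _).symm) le_rfl)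
  obtain ⟨⟨_, v⟩, ⟨rfl, -⟩, hv⟩ := h.exists_mem_separatrix_of_isPreconnected
    (isPreconnected_singleton.prod isPreconnected_Icc) hsq ⟨_, hmax, htop⟩ ⟨_, hmin, hbot⟩
  exact ⟨v, hv⟩

/-- The separatrix as the graph of the function `u ↦ -sepFun u`. -/
def sepFun (u : ℝ) : ℝ := -(h.exists_mem_separatrix u).choose

lemma mk_neg_sepFun_mem (u : ℝ) : (u, -h.sepFun u) ∈ separatrix b c := by
  rw [sepFun, neg_neg]
  exact (h.exists_mem_separatrix u).choose_spec

lemma mem_separatrix_iff : z ∈ separatrix b c ↔ h.sepFun z.1 + z.2 = 0 := by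
  have hmem := h.mk_neg_sepFun_mem z.1
  constructor <;> intro hz
  · rcases le_total z.2 (-h.sepFun z.1) with hle | hle
    · have := congrArg Prod.snd (h.eq_of_le_of_mem_separatrix hz hmem ⟨le_rfl, hle⟩)
      simp [this]
    · have := congrArg Prod.snd (h.eq_of_le_of_mem_separatrix hmem hz ⟨le_rfl, hle⟩)
      simp [← this]
  · rwa [← eq_neg_of_add_eq_zero_right hz] at hmem

lemma strictMono_sepFun : StrictMono h.sepFun := fun x y hxy => by
  by_contra! hle
  exact hxy.ne (congrArg Prod.fst (h.eq_of_le_of_mem_separatrix (h.mk_neg_sepFun_mem x)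
    (h.mk_neg_sepFun_mem y) ⟨hxy.le, neg_le_neg hle⟩))

lemma surjective_sepFun : Surjective h.sepFun := fun y => by
  obtain ⟨x, hx⟩ := h.swap.exists_mem_separatrix (-y)
  exact ⟨x, by simpa [← sub_eq_add_neg, sub_eq_zero] using
    h.mem_separatrix_iff.1 (swap_mem_separatrix hx)⟩

lemma continuous_sepFun : Continuous h.sepFun :=
  (h.strictMono_sepFun.orderIsoOfSurjective _ h.surjective_sepFun).continuous

lemma sepFun_neg (u : ℝ) : h.sepFun (-u) = -h.sepFun u := by
  have := h.mem_separatrix_iff.1 (neg_mem_separatrix (h.mk_neg_sepFun_mem u))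
  simp only [Prod.fst_neg, Prod.snd_neg, neg_neg] at this
  exact eq_neg_of_add_eq_zero_left this

lemma sepFun_of_le_abs {u : ℝ} (hu : π / 2 ≤ |u|) : h.sepFun u = u := by
  have : (u, -u) ∈ separatrix b c := .inr ⟨add_neg_cancel u, hu⟩
  exact add_neg_eq_zero.1 (h.mem_separatrix_iff.1 this)

lemma sepFun_pi_div_two : h.sepFun (π / 2) = π / 2 := h.sepFun_of_le_abs (le_abs_self _)

lemma mem_basin_sinkPt_iff_of_mem_square (hz : z ∈ square) :
    z ∈ basin (coopMap b c) sinkPt ↔ 0 < h.sepFun z.1 + z.2 := by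
  have hmem := h.mk_neg_sepFun_mem z.1
  refine ⟨fun htop => ?_, fun hpos => ?_⟩
  · by_contra! hle
    rcases hle.lt_or_eq with hlt | heq
    · have hbot := h.mem_basin_neg_sinkPt_of_lt hmem hz
        (Prod.mk_lt_mk_of_le_of_lt le_rfl (lt_neg_iff_add_neg'.2 hlt))
      exact neg_sinkPt_ne_sinkPt (eq_of_mem_basin hbot htop)
    · exact h.notMem_basin_sinkPt_of_mem_separatrix (h.mem_separatrix_iff.2 heq) htop
  · exact h.mem_basin_sinkPt_of_lt hmem hz
      (Prod.mk_lt_mk_of_le_of_lt le_rfl (neg_lt_iff_pos_add'.2 hpos))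

end WeakCoupling

/-! ### Folding and the basin of the sink -/

/-- Folds the real line at `π / 2`; folding both coordinates commutes with `coopMap b c` and
reduces the dynamics in the plane to the dynamics in the quadrant below `sinkPt`. -/
def fold (t : ℝ) : ℝ := π / 2 - |t - π / 2|

section Fold

variable {b c s t x : ℝ} {z : ℝ × ℝ}

lemma continuous_fold : Continuous fold := by unfold fold; fun_prop

lemma fold_le (t : ℝ) : fold t ≤ π / 2 := sub_le_self _ (abs_nonneg _)

lemma fold_of_le (ht : t ≤ π / 2) : fold t = t := by
  rw [fold, abs_of_nonpos (sub_nonpos.2 ht)]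
  ring

lemma fold_of_ge (ht : π / 2 ≤ t) : fold t = π - t := by
  rw [fold, abs_of_nonneg (sub_nonneg.2 ht)]
  ring

lemma fold_add_pi (ht : t ∈ Icc (-(π / 2)) (π / 2)) : fold (t + π) = -fold t := by
  rw [fold_of_le ht.2, fold_of_ge (by linarith [ht.1])]
  ring

lemma fold_eq_iff (hx : x ≤ π / 2) : fold t = x ↔ t = x ∨ t = π - x := by
  rcases le_total t (π / 2) with ht | ht
  · rw [fold_of_le ht]; grind
  · rw [fold_of_ge ht]; grind

lemma map_fold_mem_iff {S : Set (ℝ × ℝ)} (hS : S ⊆ Iic sinkPt) :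
    Prod.map fold fold z ∈ S ↔
      z ∈ S ∨ (z.1, π - z.2) ∈ S ∨ (π - z.1, z.2) ∈ S ∨ (π - z.1, π - z.2) ∈ S := by
  constructor
  · intro hz
    rcases le_total z.1 (π / 2) with h₁ | h₁ <;> rcases le_total z.2 (π / 2) with h₂ | h₂ <;>
      simp only [Prod.map, h₁, h₂, fold_of_le, fold_of_ge] at hz <;> tauto
  · rintro (hz | hz | hz | hz)
    all_goals
      convert hz using 1
      exact Prod.ext ((fold_eq_iff (hS hz).1).2 (by simp)) ((fold_eq_iff (hS hz).2).2 (by simp))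

lemma sin_fold (t : ℝ) : sin (fold t) = sin t := by
  rcases le_total t (π / 2) with ht | ht
  · rw [fold_of_le ht]
  · rw [fold_of_ge ht, sin_pi_sub]

lemma neg_pi_div_two_le_fold_iff : -(π / 2) ≤ fold t ↔ t ∈ Icc (-(π / 2)) (3 * π / 2) := by
  rw [fold, neg_le_sub_iff_le_add, abs_le, mem_Icc]
  constructor <;> rintro ⟨_, _⟩ <;> constructor <;> linarith

lemma dist_fold_pi_div_two (t : ℝ) : dist (fold t) (π / 2) = dist t (π / 2) := by
  simp [fold, Real.dist_eq]

lemma dist_map_fold_sinkPt (z : ℝ × ℝ) :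
    dist (Prod.map fold fold z) sinkPt = dist z sinkPt := by
  simp only [Prod.dist_eq, sinkPt, Prod.map_fst, Prod.map_snd, dist_fold_pi_div_two]

lemma map_fold_le_sinkPt (z : ℝ × ℝ) : Prod.map fold fold z ≤ sinkPt :=
  ⟨fold_le _, fold_le _⟩

lemma map_fold_lt_sinkPt (hz : z ≠ sinkPt) : Prod.map fold fold z < sinkPt :=
  (map_fold_le_sinkPt z).lt_of_ne fun heq =>
    hz (by rwa [← dist_eq_zero, ← dist_map_fold_sinkPt, dist_eq_zero])

lemma fold_lineMap (hs : 0 ≤ s) :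
    fold (AffineMap.lineMap (π / 2) t s) = AffineMap.lineMap (π / 2) (fold t) s := by
  simp only [fold, AffineMap.lineMap_apply_ring', add_sub_cancel_right, abs_mul, abs_of_nonneg hs]
  ring

lemma map_fold_lineMap_sinkPt (hs : 0 ≤ s) :
    Prod.map fold fold (AffineMap.lineMap sinkPt z s) =
      AffineMap.lineMap sinkPt (Prod.map fold fold z) s := by
  ext <;> simp only [sinkPt, Prod.map_fst, Prod.map_snd, AffineMap.fst_lineMap,
    AffineMap.snd_lineMap, fold_lineMap hs]

lemma sinkPt_mem_basin : sinkPt ∈ basin (coopMap b c) sinkPt :=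
  self_mem_basin (by ext <;> simp [coopMap, sinkPt])

end Fold

namespace WeakCoupling

variable {b c : ℝ} {z : ℝ × ℝ} (h : WeakCoupling b c)

include h

lemma fold_fst_coopMap (z : ℝ × ℝ) :
    fold (coopMap b c z).1 = (coopMap b c (Prod.map fold fold z)).1 := by
  rcases le_total z.1 (π / 2) with hz | hz
  · rw [fold_of_le ((h.fst_le_iff cos_pi_div_two z).2 hz)]
    simp only [coopMap, Prod.map_fst, Prod.map_snd, sin_fold, fold_of_le hz]
  · rw [fold_of_ge ((h.le_fst_iff cos_pi_div_two z).2 hz)]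
    simp only [coopMap, Prod.map_fst, Prod.map_snd, sin_fold, fold_of_ge hz, cos_pi_sub]
    ring

lemma semiconj_map_fold : Semiconj (Prod.map fold fold) (coopMap b c) (coopMap b c) := fun z =>
  Prod.ext (h.fold_fst_coopMap z) <| by
    have hswap := h.swap.fold_fst_coopMap z.swap
    rwa [← semiconj_swap.eq, ← (Semiconj.swap_map fold fold).eq, ← semiconj_swap.eq] at hswap

lemma map_fold_mem_basin_iff :
    Prod.map fold fold z ∈ basin (coopMap b c) sinkPt ↔ z ∈ basin (coopMap b c) sinkPt := by
  simp only [basin, mem_ofPred_eq, ← (h.semiconj_map_fold.iterate_right _).eq]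
  rw [tendsto_iff_dist_tendsto_zero, tendsto_iff_dist_tendsto_zero (a := sinkPt)]
  simp only [dist_map_fold_sinkPt]

/-- A defining function of the basin of `sinkPt`, its closure and its frontier. -/
def level (z : ℝ × ℝ) : ℝ := h.sepFun (fold z.1) + fold z.2

lemma continuous_level : Continuous h.level :=
  (h.continuous_sepFun.comp (continuous_fold.comp continuous_fst)).add
    (continuous_fold.comp continuous_snd)

lemma map_fold_mem_square (hz : 0 ≤ h.level z) : Prod.map fold fold z ∈ square := by
  have hpi : h.sepFun (-(π / 2)) = -(π / 2) := by rw [h.sepFun_neg, h.sepFun_pi_div_two]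
  have h₁ := fold_le z.1
  have h₂ := fold_le z.2
  have hsep := h.strictMono_sepFun.monotone h₁
  rw [h.sepFun_pi_div_two] at hsep
  rw [level] at hz
  refine ⟨⟨h.strictMono_sepFun.le_iff_le.1 ?_, h₁⟩, ?_, h₂⟩ <;> simp only [Prod.map_fst,
    Prod.map_snd, hpi] <;> linarith

lemma mem_basin_sinkPt_iff : z ∈ basin (coopMap b c) sinkPt ↔ 0 < h.level z := by
  have hneg : cos (-(π / 2)) = 0 := by simp
  have hlt : -(π / 2) < π / 2 := neg_lt_self pi_div_two_pos
  rw [← h.map_fold_mem_basin_iff]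
  constructor <;> intro hz
  · exact (h.mem_basin_sinkPt_iff_of_mem_square
      ⟨⟨(h.lt_fst_of_mem_basin hneg hz hlt).le, fold_le _⟩,
        (h.lt_snd_of_mem_basin hneg hz hlt).le, fold_le _⟩).1 hz
  · exact (h.mem_basin_sinkPt_iff_of_mem_square (h.map_fold_mem_square hz.le)).2 hz

lemma isOpen_basin_sinkPt : IsOpen (basin (coopMap b c) sinkPt) := by
  simp only [Set.ext fun z => h.mem_basin_sinkPt_iff (z := z)]
  exact isOpen_lt continuous_const h.continuous_level

lemma isBounded_basin_sinkPt : Bornology.IsBounded (basin (coopMap b c) sinkPt) :=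
  (isCompact_Icc.prod isCompact_Icc).isBounded.subset fun _ hz =>
    have hsq := h.map_fold_mem_square (h.mem_basin_sinkPt_iff.1 hz).le
    mk_mem_prod (neg_pi_div_two_le_fold_iff.1 hsq.1.1) (neg_pi_div_two_le_fold_iff.1 hsq.2.1)

lemma level_lt_level_lineMap (hz : z ≠ sinkPt) {s : ℝ} (hs : 0 ≤ s) (hs₁ : s < 1) :
    h.level z < h.level (AffineMap.lineMap sinkPt z s) := by
  have hmono : StrictMono fun w : ℝ × ℝ => h.sepFun w.1 + w.2 := fun w w' hw =>
    (Prod.lt_iff.1 hw).elim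
      (fun hw => add_lt_add_of_lt_of_le (h.strictMono_sepFun hw.1) hw.2)
      fun hw => add_lt_add_of_le_of_lt (h.strictMono_sepFun.monotone hw.1) hw.2
  have hlt : Prod.map fold fold z < Prod.map fold fold (AffineMap.lineMap sinkPt z s) := by
    have hfold := map_fold_lt_sinkPt hz
    rw [map_fold_lineMap_sinkPt hs, ← AffineMap.lineMap_apply_one_sub]
    rw [Prod.lt_iff] at hfold ⊢
    simpa only [AffineMap.fst_lineMap, AffineMap.snd_lineMap,
      left_lt_lineMap_iff_lt (sub_pos.2 hs₁), left_le_lineMap_iff_le (sub_pos.2 hs₁)] using hfold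
  simpa only [level, Prod.map_fst, Prod.map_snd] using hmono hlt

lemma lineMap_mem_basin_sinkPt (hz : 0 ≤ h.level z) {s : ℝ} (hs : 0 ≤ s) (hs₁ : s < 1) :
    AffineMap.lineMap sinkPt z s ∈ basin (coopMap b c) sinkPt := by
  rcases eq_or_ne z sinkPt with rfl | hne
  · simpa using sinkPt_mem_basin
  · exact h.mem_basin_sinkPt_iff.2 (hz.trans_lt (h.level_lt_level_lineMap hne hs hs₁))

lemma isSimplyConnected_basin_sinkPt : IsSimplyConnected (basin (coopMap b c) sinkPt) := by
  have hstar : StarConvex ℝ sinkPt (basin (coopMap b c) sinkPt) := by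
    rw [starConvex_iff_segment_subset]
    rintro z hz _ hw
    rw [segment_eq_image_lineMap] at hw
    obtain ⟨s, ⟨hs, hs₁⟩, rfl⟩ := hw
    rcases hs₁.lt_or_eq with hs₁ | rfl
    · exact h.lineMap_mem_basin_sinkPt (h.mem_basin_sinkPt_iff.1 hz).le hs hs₁
    · rwa [AffineMap.lineMap_apply_one]
  have := hstar.contractibleSpace ⟨_, sinkPt_mem_basin⟩
  unfold IsSimplyConnected
  infer_instance

lemma closure_basin_sinkPt : closure (basin (coopMap b c) sinkPt) = {z | 0 ≤ h.level z} := by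
  refine Subset.antisymm (closure_minimal (fun z hz => (h.mem_basin_sinkPt_iff.1 hz).le)
    (isClosed_le continuous_const h.continuous_level)) fun z hz => ?_
  have hlim : Tendsto (AffineMap.lineMap sinkPt z : ℝ → ℝ × ℝ) (𝓝[<] 1) (𝓝 z) := by
    simpa using ((AffineMap.lineMap_continuous (R := ℝ) (p := sinkPt) (q := z)).tendsto 1).mono_left
      nhdsWithin_le_nhds
  refine mem_closure_of_tendsto hlim ?_
  filter_upwards [Ioo_mem_nhdsLT zero_lt_one] with s hs
  exact h.lineMap_mem_basin_sinkPt hz hs.1.le hs.2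

lemma frontier_basin_sinkPt :
    frontier (basin (coopMap b c) sinkPt) = Prod.map fold fold ⁻¹' separatrix b c := by
  ext z
  rw [h.isOpen_basin_sinkPt.frontier_eq, h.closure_basin_sinkPt, Set.mem_sdiff,
    h.mem_basin_sinkPt_iff, not_lt, mem_preimage, h.mem_separatrix_iff]
  exact and_comm.trans le_antisymm_iff.symm

lemma mem_frontier_basin_sinkPt_iff : z ∈ frontier (basin (coopMap b c) sinkPt) ↔
    z ∈ separatrix b c ∩ square ∨ (z.1, π - z.2) ∈ separatrix b c ∩ square ∨
      (z.1 - π, -z.2) ∈ separatrix b c ∩ square ∨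
      (z.1 - π, z.2 - π) ∈ separatrix b c ∩ square := by
  have hneg (w : ℝ × ℝ) : -w ∈ separatrix b c ∩ square ↔ w ∈ separatrix b c ∩ square :=
    ⟨fun hw => neg_neg w ▸ ⟨neg_mem_separatrix hw.1, neg_mem_square hw.2⟩,
      fun hw => ⟨neg_mem_separatrix hw.1, neg_mem_square hw.2⟩⟩
  rw [h.frontier_basin_sinkPt, ← hneg (z.1 - π, _), ← hneg (z.1 - π, z.2 - π)]
  simp only [Prod.neg_mk, neg_neg, neg_sub]
  rw [← map_fold_mem_iff fun w hw => ⟨hw.2.1.2, hw.2.2.2⟩]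
  exact ⟨fun hz => ⟨hz, h.map_fold_mem_square (h.mem_separatrix_iff.1 hz).ge⟩, And.left⟩

theorem exists_level_nonneg (z : ℝ × ℝ) :
    ∃ m n : ℤ, Even (m + n) ∧ 0 ≤ h.level (z.1 - π * m, z.2 - π * n) := by
  have hround (x : ℝ) : ∃ m : ℤ, x - π * m ∈ Icc (-(π / 2)) (π / 2) := by
    obtain ⟨m, hm, -⟩ := existsUnique_sub_zsmul_mem_Ico pi_pos x (-(π / 2))
    rw [zsmul_eq_mul, mul_comm, show -(π / 2) + π = π / 2 by ring] at hm
    exact ⟨m, Ico_subset_Icc_self hm⟩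
  have hpred (x : ℝ) (m : ℤ) : x - π * ((m - 1 : ℤ) : ℝ) = x - π * m + π := by push_cast; ring
  obtain ⟨m, hm⟩ := hround z.1
  obtain ⟨n, hn⟩ := hround z.2
  have hodd := h.sepFun_neg (fold (z.1 - π * m))
  rcases Int.even_or_odd (m + n) with hmn | hmn
  · rcases le_total 0 (h.level (z.1 - π * m, z.2 - π * n)) with hs | hs
    · exact ⟨m, n, hmn, hs⟩
    · refine ⟨m - 1, n - 1, by grind, ?_⟩
      simp only [level, hpred, fold_add_pi hm, fold_add_pi hn, hodd] at hs ⊢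
      linarith
  · rcases le_total 0 (h.level (z.1 - π * m, z.2 - π * n + π)) with hs | hs
    · exact ⟨m, n - 1, by grind, hpred z.2 n ▸ hs⟩
    · refine ⟨m - 1, n, by grind, ?_⟩
      simp only [level, hpred, fold_add_pi hm, fold_add_pi hn, hodd] at hs ⊢
      linarith

end WeakCoupling

/-! ### The branches at the saddle -/

/-- The half of the stable set of the origin that lies in the second quadrant; the other half is
its image under the symmetry `z ↦ -z`. -/
def arc (b c : ℝ) : Set (ℝ × ℝ) := basin (coopMap b c) 0 ∩ upperLeft

namespace WeakCoupling

variable {b c : ℝ} {z : ℝ × ℝ} (h : WeakCoupling b c)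

include h

lemma basin_zero_cases (hz : z ∈ basin (coopMap b c) 0) :
    z = 0 ∨ z ∈ arc b c ∨ -z ∈ arc b c := by
  have hzero := self_mem_basin (isFixedPt_coopMap_zero (b := b) (c := c))
  have hneg : -z ∈ basin (coopMap b c) 0 := by simpa using neg_mem_basin_neg hz
  rcases quadrant_cases z with h0 | h0 | hul | hul
  · exact .inl (h.eq_of_le_of_mem_basin_zero hzero hz h0).symm
  · exact .inl (h.eq_of_le_of_mem_basin_zero hz hzero h0)
  · exact .inr (.inl ⟨hz, hul⟩)
  · exact .inr (.inr ⟨hneg, hul⟩)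

lemma coopMap_mem_arc_iff : coopMap b c z ∈ arc b c ↔ z ∈ arc b c := by
  refine ⟨fun hz => ?_, fun hz => ?_⟩
  · have hz₀ := map_mem_basin_iff.1 hz.1
    exact ⟨hz₀, h.mem_upperLeft_of_coopMap_mem (h.mem_square_of_mem_basin_zero hz₀) hz.2⟩
  · rcases h.basin_zero_cases (map_mem_basin_iff.2 hz.1) with h0 | harc | harc
    · rw [h.homeo.injective (h0.trans isFixedPt_coopMap_zero.symm)] at hz
      exact (lt_irrefl (0 : ℝ) hz.2.1).elim
    · exact harc
    · rw [← coopMap_neg] at harc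
      exact absurd (h.mem_upperLeft_of_coopMap_mem
        (neg_mem_square (h.mem_square_of_mem_basin_zero hz.1)) harc.2) (neg_notMem_upperLeft hz.2)

lemma mem_separatrix_inter_square_iff : z ∈ separatrix b c ∩ square ↔
    z = vertex ∨ z ∈ arc b c ∨ z = 0 ∨ -z ∈ arc b c ∨ z = -vertex := by
  constructor
  · rintro ⟨h0 | ⟨hsum, habs⟩, hz⟩
    · rcases h.basin_zero_cases h0 with h0 | h0 | h0 <;> tauto
    · have hneg := eq_neg_of_add_eq_zero_right hsum
      rcases le_abs.1 habs with habs | habs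
      · have h₁ : z.1 = π / 2 := hz.1.2.antisymm habs
        exact .inr (.inr (.inr (.inr
          (Prod.ext (by simp [vertex, h₁]) (by simp [vertex, hneg, h₁])))))
      · have h₁ : z.2 = π / 2 := hz.2.2.antisymm (habs.trans_eq hneg.symm)
        exact .inl (Prod.ext (by simp [vertex, ← h₁, hneg]) h₁)
  · have harc {w} (hw : w ∈ arc b c) : w ∈ separatrix b c ∩ square :=
      ⟨.inl hw.1, h.mem_square_of_mem_basin_zero hw.1⟩
    rintro (rfl | hz | rfl | hz | rfl)
    · exact ⟨vertex_mem_separatrix, vertex_mem_square⟩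
    · exact harc hz
    · exact ⟨.inl (self_mem_basin isFixedPt_coopMap_zero), zero_mem_square⟩
    · exact neg_neg z ▸ ⟨neg_mem_separatrix (harc hz).1, neg_mem_square (harc hz).2⟩
    · exact ⟨neg_mem_separatrix vertex_mem_separatrix, neg_mem_square vertex_mem_square⟩

lemma coopMap_symm_iterate_succ (n : ℕ) (z : ℝ × ℝ) :
    coopMap b c (h.homeo.symm^[n + 1] z) = h.homeo.symm^[n] z := by
  rw [iterate_succ_apply']
  exact h.homeo.apply_symm_apply _

lemma iterate_coopMap_iterate_symm (n : ℕ) (z : ℝ × ℝ) :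
    (coopMap b c)^[n] (h.homeo.symm^[n] z) = z :=
  (LeftInverse.iterate (f := h.homeo.symm) (g := coopMap b c) h.homeo.apply_symm_apply n) z

lemma iterate_symm_mem_square (hz : z ∈ square) (n : ℕ) : h.homeo.symm^[n] z ∈ square := by
  rwa [← h.iterate_mem_square_iff n, h.iterate_coopMap_iterate_symm]

lemma exists_isFixedPt_mem_basin_symm (hz : z ∈ square)
    (h₁ : Monotone (fun n => (h.homeo.symm^[n] z).1) ∨ Antitone (fun n => (h.homeo.symm^[n] z).1))
    (h₂ : Monotone (fun n => (h.homeo.symm^[n] z).2) ∨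
      Antitone (fun n => (h.homeo.symm^[n] z).2)) :
    ∃ p ∈ square, IsFixedPt (coopMap b c) p ∧ z ∈ basin h.homeo.symm p := by
  obtain ⟨p, hp, hfix, hlim⟩ := exists_isFixedPt_mem_basin h.homeo.symm.continuous
    isCompact_square (h.iterate_symm_mem_square hz) h₁ h₂
  exact ⟨p, hp, (h.homeo.symm_apply_eq.1 hfix).symm, hlim⟩

lemma mem_basin_symm_vertex_of_mem_arc (hz : z ∈ arc b c) : z ∈ basin h.homeo.symm vertex := by
  have hsq := h.iterate_symm_mem_square (h.mem_square_of_mem_basin_zero hz.1)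
  have harc n : h.homeo.symm^[n] z ∈ arc b c := by
    induction n with
    | zero => exact hz
    | succ n ih => rwa [← h.coopMap_mem_arc_iff, h.coopMap_symm_iterate_succ]
  have hfst : Antitone fun n => (h.homeo.symm^[n] z).1 := antitone_nat_of_succ_le fun n => by
    simpa only [h.coopMap_symm_iterate_succ] using
      h.le_fst_coopMap (hsq (n + 1)) (le_of_lt (harc (n + 1)).2.2)
  have hsnd : Monotone fun n => (h.homeo.symm^[n] z).2 := monotone_nat_of_le_succ fun n => by
    simpa only [h.coopMap_symm_iterate_succ] using
      h.snd_coopMap_le (hsq (n + 1)) (le_of_lt (harc (n + 1)).2.1)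
  obtain ⟨y, hy, hfix, hlim⟩ := h.exists_isFixedPt_mem_basin_symm (hsq 0) (.inr hfst) (.inl hsnd)
  have hy₁ : y.1 < 0 := (hfst.le_of_tendsto hlim.fst_nhds 0).trans_lt hz.2.1
  have hy₂ : 0 < y.2 := lt_of_lt_of_le hz.2.2 (hsnd.ge_of_tendsto hlim.snd_nhds 0)
  have hpos := pi_div_two_pos
  rcases h.isFixedPt_cases hy hfix with rfl | ⟨h₁, h₂⟩
  · exact absurd hy₁ (lt_irrefl _)
  · rwa [show vertex = y from Prod.ext (h₁.resolve_left fun e => by linarith).symm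
      (h₂.resolve_right fun e => by linarith).symm]

lemma sepFun_zero : h.sepFun 0 = 0 :=
  self_eq_neg.1 (by simpa only [neg_zero] using h.sepFun_neg 0)

lemma image_Ioo_eq_arc : (fun u => (u, -h.sepFun u)) '' Ioo (-(π / 2)) 0 = arc b c := by
  ext z
  constructor
  · rintro ⟨u, ⟨hu, hu0⟩, rfl⟩
    have hsep : h.sepFun u < 0 := h.sepFun_zero ▸ h.strictMono_sepFun hu0
    exact ⟨(h.mk_neg_sepFun_mem u).resolve_right fun hv =>
      hv.2.not_gt (abs_lt.2 ⟨hu, hu0.trans pi_div_two_pos⟩), hu0, neg_pos.2 hsep⟩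
  · rintro ⟨hz, hul⟩
    exact ⟨z.1, ⟨(h.mem_Ioo_of_mem_basin_zero hz).1.1, hul.1⟩,
      Prod.ext rfl (eq_neg_of_add_eq_zero_right (h.mem_separatrix_iff.1 (.inl hz))).symm⟩

end WeakCoupling

lemma range_arctan_div_two_sub : range (fun t => arctan t / 2 - π / 4) = Ioo (-(π / 2)) 0 := by
  have hcomp : (fun t => arctan t / 2 - π / 4) = (fun x => (1 / 2) * x - π / 4) ∘ arctan := by
    ext t; simp only [comp_apply]; ring
  rw [hcomp, range_comp, range_arctan, ← image_image (fun x => x - π / 4) (fun x => 1 / 2 * x)]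
  rw [image_mul_left_Ioo one_half_pos, image_sub_const_Ioo]
  congr 1 <;> ring

namespace WeakCoupling

variable {b c : ℝ} {z : ℝ × ℝ} (h : WeakCoupling b c)

include h

theorem isHeteroclinicCurve_arc : IsHeteroclinicCurve (coopMap b c) vertex 0 (arc b c) := by
  have hgraph : Continuous fun u => (u, -h.sepFun u) :=
    continuous_id.prodMk h.continuous_sepFun.neg
  have hlim {l : Filter ℝ} {x : ℝ} (hl : Tendsto arctan l (𝓝 x)) :
      Tendsto (fun t => (fun u => (u, -h.sepFun u)) (arctan t / 2 - π / 4)) l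
        (𝓝 (x / 2 - π / 4, -h.sepFun (x / 2 - π / 4))) :=
    (hgraph.tendsto _).comp ((hl.div_const 2).sub_const _)
  refine ⟨⟨fun t => (fun u => (u, -h.sepFun u)) (arctan t / 2 - π / 4),
    hgraph.comp (by fun_prop), fun s t hst => ?_, ?_, ?_, ?_⟩, ?_, fun z hz =>
      ⟨fullOrbit h.homeo z, isOrbit_fullOrbit h.homeo, fullOrbit_zero h.homeo,
        tendsto_fullOrbit_atBot h.homeo (h.mem_basin_symm_vertex_of_mem_arc hz),
        tendsto_fullOrbit_atTop h.homeo hz.1⟩⟩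
  · have := congrArg Prod.fst hst
    simp only at this
    exact arctan_injective (by linarith)
  · rw [← h.image_Ioo_eq_arc, ← range_arctan_div_two_sub, ← range_comp]
    rfl
  · convert hlim (tendsto_arctan_atBot.mono_right nhdsWithin_le_nhds) using 2
    rw [show -(π / 2) / 2 - π / 4 = -(π / 2) by ring, h.sepFun_neg, h.sepFun_pi_div_two, neg_neg]
    rfl
  · convert hlim (tendsto_arctan_atTop.mono_right nhdsWithin_le_nhds) using 2
    rw [show π / 2 / 2 - π / 4 = 0 by ring, h.sepFun_zero, neg_zero]
    rfl
  · exact (h.homeo.image_eq_preimage_symm _).trans (Set.ext fun z => by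
      rw [mem_preimage, ← h.coopMap_mem_arc_iff]
      exact iff_of_eq (congrArg (· ∈ arc b c) (h.homeo.apply_symm_apply z)))

lemma mem_basin_symm_zero_of_nonneg (hz : z ∈ square) (hne : z ≠ sinkPt)
    (h0 : ∀ n, 0 ≤ h.homeo.symm^[n] z) : z ∈ basin h.homeo.symm 0 := by
  have hsq := h.iterate_symm_mem_square hz
  have hfst : Antitone fun n => (h.homeo.symm^[n] z).1 := antitone_nat_of_succ_le fun n => by
    simpa only [h.coopMap_symm_iterate_succ] using
      h.le_fst_coopMap (hsq (n + 1)) (h0 (n + 1)).2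
  have hsnd : Antitone fun n => (h.homeo.symm^[n] z).2 := antitone_nat_of_succ_le fun n => by
    simpa only [h.coopMap_symm_iterate_succ] using
      h.le_snd_coopMap (hsq (n + 1)) (h0 (n + 1)).1
  obtain ⟨y, hy, hfix, hlim⟩ := h.exists_isFixedPt_mem_basin_symm hz (.inr hfst) (.inr hsnd)
  have hyz : y ≤ z := ⟨hfst.le_of_tendsto hlim.fst_nhds 0, hsnd.le_of_tendsto hlim.snd_nhds 0⟩
  have hy0 : 0 ≤ y := ⟨ge_of_tendsto' hlim.fst_nhds fun n => (h0 n).1,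
    ge_of_tendsto' hlim.snd_nhds fun n => (h0 n).2⟩
  have hneg : ¬ 0 ≤ -(π / 2) := not_le.2 (neg_lt_zero.2 pi_div_two_pos)
  rcases h.isFixedPt_cases hy hfix with rfl | ⟨h₁, h₂⟩
  · exact hlim
  · have h₁ := h₁.resolve_right fun e => hneg (e ▸ hy0.1)
    have h₂ := h₂.resolve_right fun e => hneg (e ▸ hy0.2)
    exact absurd (Prod.ext (hz.1.2.antisymm (h₁ ▸ hyz.1)) (hz.2.2.antisymm (h₂ ▸ hyz.2))) hne

lemma iterate_symm_neg (n : ℕ) (z : ℝ × ℝ) : h.homeo.symm^[n] (-z) = -h.homeo.symm^[n] z := by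
  have hneg : Semiconj Neg.neg h.homeo.symm h.homeo.symm := fun z =>
    (h.homeo.symm_apply_eq.2 ((congrArg _ (h.homeo.apply_symm_apply z).symm).trans
      (coopMap_neg _).symm)).symm
  exact ((hneg.iterate_right n).eq z).symm

lemma iterate_symm_mem_upperLeft (hz : z ∈ square) (hul : z ∈ upperLeft) (n : ℕ) :
    h.homeo.symm^[n] z ∈ upperLeft := by
  induction n with
  | zero => exact hul
  | succ n ih =>
    refine h.mem_upperLeft_of_coopMap_mem (h.iterate_symm_mem_square hz (n + 1)) ?_
    rwa [h.coopMap_symm_iterate_succ]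

lemma neg_iterate_symm_notMem_upperLeft (hz : z ∈ square) {m : ℕ}
    (hm : h.homeo.symm^[m] z ∈ upperLeft) (n : ℕ) : -h.homeo.symm^[n] z ∉ upperLeft := fun hn => by
  have hm' := h.iterate_symm_mem_upperLeft (h.iterate_symm_mem_square hz m) hm n
  have hn' := h.iterate_symm_mem_upperLeft
    (neg_mem_square (h.iterate_symm_mem_square hz n)) hn m
  rw [h.iterate_symm_neg, ← iterate_add_apply, add_comm, iterate_add_apply] at hn'
  exact neg_notMem_upperLeft hm' hn'

lemma symm_zero_pi_div_two_mem_upperLeft : h.homeo.symm (0, π / 2) ∈ upperLeft := by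
  have hK : coopMap b c (h.homeo.symm (0, π / 2)) = (0, π / 2) := h.homeo.apply_symm_apply _
  generalize h.homeo.symm (0, π / 2) = w at hK
  have hle := h.snd_le_iff cos_pi_div_two w
  have hge := h.le_snd_iff cos_pi_div_two w
  simp only [hK, le_rfl, true_iff] at hle hge
  have h₂ : w.2 = π / 2 := hle.antisymm hge
  refine ⟨(h.strictMono_fst (π / 2)).lt_iff_lt.1 ?_, h₂ ▸ pi_div_two_pos⟩
  simpa [← h₂, hK] using (by simp [coopMap, h₂, h.b_pos] : 0 < (coopMap b c (0, w.2)).1)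

lemma neg_symm_pi_div_two_zero_mem_upperLeft : -h.homeo.symm (π / 2, 0) ∈ upperLeft := by
  have hswap : h.homeo.symm (π / 2, 0) = (h.swap.homeo.symm (0, π / 2)).swap :=
    h.homeo.symm_apply_eq.2 <| (congrArg Prod.swap
      (h.swap.homeo.apply_symm_apply (0, π / 2))).symm.trans (semiconj_swap.eq _)
  have hmem := h.swap.symm_zero_pi_div_two_mem_upperLeft
  rw [hswap]
  exact ⟨mem_Iio.2 (neg_lt_zero.2 hmem.2), neg_pos.2 (mem_Iio.1 hmem.1)⟩

theorem exists_mem_basin_symm_zero :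
    ∃ z ∈ square, 0 ≤ z ∧ z ≠ 0 ∧ z ∈ basin h.homeo.symm 0 := by
  have hpos := pi_div_two_pos
  -- The inverse map sends one end of the segment `s` to the second quadrant and the other end to
  -- the fourth, so the backward orbit of some point of `s` never leaves the first quadrant.
  let s : Set (ℝ × ℝ) := (fun u => (u, π / 2 - u)) '' Icc 0 (π / 2)
  have hs {z} (hz : z ∈ s) : 0 ≤ z ∧ z ∈ square ∧ z.1 + z.2 = π / 2 := by
    obtain ⟨u, ⟨hu, hu'⟩, rfl⟩ := hz
    refine ⟨⟨hu, sub_nonneg.2 hu'⟩, ⟨⟨?_, hu'⟩, ?_, sub_le_self _ hu⟩, ?_⟩ <;> simp <;> linarith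
  obtain ⟨z, hz, hn⟩ := exists_forall_iterate_notMem (U := upperLeft)
    (V := Neg.neg ⁻¹' upperLeft) h.homeo.symm.continuous
    (isPreconnected_Icc.image (fun u => (u, π / 2 - u)) (by fun_prop)) isOpen_upperLeft
    (isOpen_upperLeft.preimage continuous_neg)
    ⟨(0, π / 2), ⟨0, ⟨le_rfl, hpos.le⟩, by simp⟩, 1, h.symm_zero_pi_div_two_mem_upperLeft⟩
    ⟨(π / 2, 0), ⟨π / 2, ⟨hpos.le, le_rfl⟩, by simp⟩, 1, h.neg_symm_pi_div_two_zero_mem_upperLeft⟩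
    fun z hz m n hm => h.neg_iterate_symm_notMem_upperLeft (hs hz).2.1 hm n
  obtain ⟨h0, hsq, hsum⟩ := hs hz
  have hne : z ≠ 0 := fun e => by simp [e] at hsum; linarith
  refine ⟨z, hsq, h0, hne, h.mem_basin_symm_zero_of_nonneg hsq (fun e => ?_) fun n => ?_⟩
  · simp only [e, sinkPt] at hsum; linarith
  · rcases quadrant_cases (h.homeo.symm^[n] z) with hnn | hnp | hul | hul
    · exact hnn
    · have hle := h.iterate_coopMap_le (h.iterate_symm_mem_square hsq n) zero_mem_square hnp n
      rw [h.iterate_coopMap_iterate_symm, (isFixedPt_coopMap_zero.iterate n).eq] at hle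
      exact absurd (hle.antisymm h0) hne
    · exact absurd hul (hn n).1
    · exact absurd hul (hn n).2

theorem isSaddleIn_closure_basin {φ f : ℝ × ℝ → ℝ × ℝ} (hφ : Continuous φ) (hi : Injective φ)
    (hf : Semiconj φ (coopMap b c) f) (hsaddle : IsSaddle f (φ 0)) :
    IsSaddleIn f (closure (basin f (φ sinkPt))) (φ 0) := by
  have hmem {z} (hz : z ∈ square) (hsep : 0 ≤ h.sepFun z.1 + z.2) :
      φ z ∈ closure (basin f (φ sinkPt)) := by
    have hcl : z ∈ closure (basin (coopMap b c) sinkPt) := by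
      rw [h.closure_basin_sinkPt]
      simpa only [level, mem_ofPred_eq, fold_of_le hz.1.2, fold_of_le hz.2.2] using hsep
    exact map_mem_closure hφ hcl fun w hw => mem_basin_of_semiconj hφ hf hw
  obtain ⟨γ, -, -, hγ, -⟩ := h.isHeteroclinicCurve_arc.1
  have harc : γ 0 ∈ arc b c := hγ ▸ mem_range_self 0
  obtain ⟨z, hz, h0, hne, hlim⟩ := h.exists_mem_basin_symm_zero
  refine ⟨hmem zero_mem_square ?_, hsaddle, ⟨φ (γ 0), hmem ?_ ?_, hi.ne ?_, ?_⟩,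
    ⟨φ z, hmem hz ?_, hi.ne hne, ?_⟩⟩
  · exact (h.mem_separatrix_iff.1 (.inl (self_mem_basin isFixedPt_coopMap_zero))).ge
  · exact h.mem_square_of_mem_basin_zero harc.1
  · exact (h.mem_separatrix_iff.1 (.inl harc.1)).ge
  · exact fun heq => (heq ▸ mem_Iio.1 harc.2.1 : (0 : ℝ × ℝ).1 < 0).false
  · exact mem_basin_of_semiconj hφ hf harc.1
  · exact add_nonneg (h.sepFun_zero ▸ h.strictMono_sepFun.monotone h0.1) h0.2
  · exact mem_unstableSet_of_semiconj hφ hf (mem_unstableSet_of_mem_basin_symm h.homeo hlim)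

end WeakCoupling

/-! ### Multipliers of the fixed points -/

section Multipliers

variable {a r s : ℝ} {p : ℝ × ℝ}

lemma hasFDerivAt_F (a : ℝ) (p : ℝ × ℝ) : HasFDerivAt (F a)
    (((1 + 2 * a * cos p.1) • ContinuousLinearMap.fst ℝ ℝ ℝ +
      (a * cos p.2) • ContinuousLinearMap.snd ℝ ℝ ℝ).prod
      ((a * cos p.1) • ContinuousLinearMap.fst ℝ ℝ ℝ +
        (1 + 2 * a * cos p.2) • ContinuousLinearMap.snd ℝ ℝ ℝ)) p := by
  have h₁ : HasFDerivAt (fun z : ℝ × ℝ => z.1) (ContinuousLinearMap.fst ℝ ℝ ℝ) p := hasFDerivAt_fst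
  have h₂ : HasFDerivAt (fun z : ℝ × ℝ => z.2) (ContinuousLinearMap.snd ℝ ℝ ℝ) p := hasFDerivAt_snd
  refine (((h₁.add (h₁.sin.const_mul (2 * a))).add (h₂.sin.const_mul a)).prodMk
    ((h₂.add (h₁.sin.const_mul a)).add (h₂.sin.const_mul (2 * a)))).congr_fderiv ?_
  ext <;> simp [mul_assoc]

lemma charpoly_fderiv_F (a : ℝ) (p : ℝ × ℝ) :
    ((fderiv ℝ (F a) p : ℝ × ℝ →L[ℝ] ℝ × ℝ) : ℝ × ℝ →ₗ[ℝ] ℝ × ℝ).charpoly =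
      !![1 + 2 * a * cos p.1, a * cos p.2; a * cos p.1, 1 + 2 * a * cos p.2].charpoly := by
  rw [← LinearMap.charpoly_toMatrix _ (Module.Basis.finTwoProd ℝ),
    ← LinearMap.toMatrix_toLin (Module.Basis.finTwoProd ℝ) (Module.Basis.finTwoProd ℝ)
      !![_, _; _, _],
    Matrix.toLin_finTwoProd, (hasFDerivAt_F a p).fderiv]
  rfl

lemma mem_multipliers_F_iff (htrace : 2 + 2 * a * (cos p.1 + cos p.2) = r + s)
    (hdet : 1 + 2 * a * (cos p.1 + cos p.2) + 3 * a ^ 2 * (cos p.1 * cos p.2) = r * s) {μ : ℂ} :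
    μ ∈ multipliers (F a) p ↔ μ = r ∨ μ = s := by
  have hfactor : !![1 + 2 * a * cos p.1, a * cos p.2; a * cos p.1, 1 + 2 * a * cos p.2].charpoly =
      (Polynomial.X - Polynomial.C r) * (Polynomial.X - Polynomial.C s) := by
    rw [Matrix.charpoly_fin_two, Matrix.trace_fin_two_of, Matrix.det_fin_two_of,
      show 1 + 2 * a * cos p.1 + (1 + 2 * a * cos p.2) = r + s by linear_combination htrace,
      show (1 + 2 * a * cos p.1) * (1 + 2 * a * cos p.2) - a * cos p.2 * (a * cos p.1) = r * s by
        linear_combination hdet, map_add, map_mul]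
    ring
  change μ ∈ Polynomial.aroots _ ℂ ↔ _
  rw [charpoly_fderiv_F, hfactor, Polynomial.aroots_mul (mul_ne_zero
    (Polynomial.X_sub_C_ne_zero r) (Polynomial.X_sub_C_ne_zero s))]
  simp

lemma F_eq_self (h₁ : sin p.1 = 0) (h₂ : sin p.2 = 0) : F a p = p := by
  ext <;> simp [F, h₁, h₂]

lemma isSink_F_pi_pi (ha0 : 0 < a) (ha1 : 3 * a < 2) : IsSink (F a) (π, π) := by
  refine ⟨F_eq_self sin_pi sin_pi, (hasFDerivAt_F a _).differentiableAt, fun μ hμ => ?_⟩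
  rw [mem_multipliers_F_iff (r := 1 - 3 * a) (s := 1 - a) (by simp only [cos_pi]; ring)
    (by simp only [cos_pi]; ring)] at hμ
  rcases hμ with rfl | rfl <;> rw [Complex.norm_real, norm_eq_abs, abs_lt] <;>
    constructor <;> linarith

lemma sin_two_pi_mul_natCast (n : ℕ) : sin (2 * π * n) = 0 :=
  sin_eq_zero_iff.2 ⟨2 * n, by push_cast; ring⟩

lemma cos_two_pi_mul_natCast (n : ℕ) : cos (2 * π * n) = 1 := by
  rw [mul_comm, cos_nat_mul_two_pi]

lemma isRepeller_F_corner (ha0 : 0 < a) (i j : Fin 2) : IsRepeller (F a) (corner i j) := by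
  refine ⟨F_eq_self (sin_two_pi_mul_natCast i) (sin_two_pi_mul_natCast j),
    (hasFDerivAt_F a _).differentiableAt, fun μ hμ => ?_⟩
  rw [mem_multipliers_F_iff (r := 1 + 3 * a) (s := 1 + a)
    (by simp only [corner, cos_two_pi_mul_natCast]; ring)
    (by simp only [corner, cos_two_pi_mul_natCast]; ring)] at hμ
  rcases hμ with rfl | rfl <;> rw [Complex.norm_real, norm_eq_abs, lt_abs] <;> left <;> linarith

lemma isSaddle_F (ha0 : 0 < a) (ha1 : √3 * a < 2) (h₁ : sin p.1 = 0) (h₂ : sin p.2 = 0)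
    (hadd : cos p.1 + cos p.2 = 0) (hmul : cos p.1 * cos p.2 = -1) : IsSaddle (F a) p := by
  have hsqrt : √3 * √3 = 3 := mul_self_sqrt (by norm_num)
  have hpos : 0 < √3 * a := by positivity
  have hmem (μ : ℂ) : μ ∈ multipliers (F a) p ↔
      μ = ((1 - √3 * a : ℝ) : ℂ) ∨ μ = ((1 + √3 * a : ℝ) : ℂ) :=
    mem_multipliers_F_iff (by rw [hadd]; ring)
      (by rw [hadd, hmul]; linear_combination a ^ 2 * hsqrt)
  have hlt : ‖((1 - √3 * a : ℝ) : ℂ)‖ < 1 := by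
    rw [Complex.norm_real, norm_eq_abs, abs_lt]; constructor <;> linarith
  have hgt : 1 < ‖((1 + √3 * a : ℝ) : ℂ)‖ := by
    rw [Complex.norm_real, norm_eq_abs, lt_abs]; left; linarith
  refine ⟨F_eq_self h₁ h₂, (hasFDerivAt_F a p).differentiableAt, fun μ hμ => ?_,
    ⟨_, (hmem _).2 (.inl rfl), hlt⟩, ⟨_, (hmem _).2 (.inr rfl), hgt⟩⟩
  rcases (hmem μ).1 hμ with rfl | rfl
  exacts [hlt.ne, hgt.ne']

lemma isSaddle_F_midV (ha0 : 0 < a) (ha1 : √3 * a < 2) (i : Fin 2) : IsSaddle (F a) (midV i) :=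
  isSaddle_F ha0 ha1 (sin_two_pi_mul_natCast i) sin_pi
    (by simp only [midV, cos_two_pi_mul_natCast, cos_pi]; ring)
    (by simp only [midV, cos_two_pi_mul_natCast, cos_pi]; ring)

lemma isSaddle_F_midH (ha0 : 0 < a) (ha1 : √3 * a < 2) (j : Fin 2) : IsSaddle (F a) (midH j) :=
  isSaddle_F ha0 ha1 sin_pi (sin_two_pi_mul_natCast j)
    (by simp only [midH, cos_two_pi_mul_natCast, cos_pi]; ring)
    (by simp only [midH, cos_two_pi_mul_natCast, cos_pi]; ring)

end Multipliers

/-! ### Symmetries and the boundary of the basin -/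

section Symmetry

variable {a : ℝ}

/-- The change of coordinates from the normal form `coopMap (3 * a) a` to `F a`: half the sum and
half the difference of the two phases, centred at the saddle `(0, π)`. -/
def coord : ℝ × ℝ ≃ₜ ℝ × ℝ where
  toFun z := (z.1 + z.2, π + z.1 - z.2)
  invFun z := ((z.1 + z.2 - π) / 2, (z.1 - z.2 + π) / 2)
  left_inv z := by ext <;> simp <;> ring
  right_inv z := by ext <;> simp <;> ring
  continuous_toFun := by fun_prop
  continuous_invFun := by fun_prop

lemma coord_apply (z : ℝ × ℝ) : coord z = (z.1 + z.2, π + z.1 - z.2) := rfl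

lemma coord_sinkPt : coord sinkPt = (π, π) := by
  rw [coord_apply]; ext <;> simp [sinkPt]

lemma coord_zero : coord 0 = midV 0 := by
  rw [coord_apply]; ext <;> simp [midV]

lemma coord_vertex : coord vertex = corner 0 0 := by
  rw [coord_apply]; ext <;> simp [vertex, corner]; ring

lemma coord_neg_vertex : coord (-vertex) = corner 0 1 := by
  rw [coord_apply]; ext <;> simp [vertex, corner]; ring

lemma semiconj_coord (a : ℝ) : Semiconj coord (coopMap (3 * a) a) (F a) := fun z => by
  have hsin : sin (π + z.1 - z.2) = -sin (z.1 - z.2) := by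
    rw [add_sub_assoc, add_comm, sin_add_pi]
  rw [coord_apply, coord_apply]
  ext <;> simp only [coopMap, F, hsin, sin_add, sin_sub] <;> ring

lemma semiconj_coord_symm (a : ℝ) : Semiconj coord.symm (F a) (coopMap (3 * a) a) :=
  (semiconj_coord a).inverse_left coord.symm_apply_apply coord.apply_symm_apply

lemma basin_F_pi_pi (a : ℝ) :
    basin (F a) (π, π) = coord '' basin (coopMap (3 * a) a) sinkPt := by
  rw [coord.image_eq_preimage_symm]
  refine Subset.antisymm (fun z hz => ?_) fun z hz => ?_
  · simpa only [mem_preimage, ← coord_sinkPt, coord.symm_apply_apply] using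
      mem_basin_of_semiconj coord.symm.continuous (semiconj_coord_symm a) hz
  · simpa only [coord_sinkPt, coord.apply_symm_apply] using
      mem_basin_of_semiconj coord.continuous (semiconj_coord a) hz

lemma translation_eq_addRight (l k : ℤ) :
    translation l k = Homeomorph.addRight (2 * π * l, 2 * π * k) := rfl

lemma continuous_translation (l k : ℤ) : Continuous (translation l k) :=
  translation_eq_addRight l k ▸ Homeomorph.continuous _

lemma injective_translation (l k : ℤ) : Injective (translation l k) :=
  translation_eq_addRight l k ▸ Homeomorph.injective _

lemma semiconj_translation (a : ℝ) (l k : ℤ) : Semiconj (translation l k) (F a) (F a) := fun z => by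
  have hsin (x : ℝ) (n : ℤ) : sin (x + 2 * π * n) = sin x := by
    rw [mul_comm (2 * π), sin_add_int_mul_two_pi]
  ext <;> simp only [translation, F, hsin] <;> ring

lemma semiconj_swap_F (a : ℝ) : Semiconj Prod.swap (F a) (F a) := fun z => by
  ext <;> simp only [F, Prod.fst_swap, Prod.snd_swap] <;> ring

/-- The symmetry of `F a` that carries the boundary arc from `(0, 0)` to `(0, π)` to the one from
`(2πi, 2πj)` to `(2πi, π)`, for `i, j ∈ {0, 1}`. -/
def edgeSymm (i j : ℕ) (z : ℝ × ℝ) : ℝ × ℝ := translation i j ((-1 : ℝ) ^ j • z)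

lemma continuous_edgeSymm (i j : ℕ) : Continuous (edgeSymm i j) :=
  (continuous_translation i j).comp (continuous_const_smul _)

lemma injective_edgeSymm (i j : ℕ) : Injective (edgeSymm i j) :=
  (injective_translation i j).comp
    (smul_right_injective _ (pow_ne_zero j (neg_ne_zero.2 one_ne_zero)))

lemma semiconj_edgeSymm (a : ℝ) (i j : ℕ) : Semiconj (edgeSymm i j) (F a) (F a) := by
  refine (semiconj_translation a i j).comp_left fun z => ?_
  rcases neg_one_pow_eq_or ℝ j with hj | hj <;> rw [hj] <;> ext <;> simp [F] <;> ring

lemma edgeSymm_corner (i j : Fin 2) : edgeSymm i j (corner 0 0) = corner i j := by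
  simp [edgeSymm, translation, corner]

lemma edgeSymm_midV (i j : Fin 2) : edgeSymm i j (midV 0) = midV i := by
  fin_cases j <;> ext <;> simp [edgeSymm, translation, midV]; ring

lemma edgeSymm_pi_pi (i : Fin 2) : edgeSymm i i (π, π) = (π, π) := by
  fin_cases i <;> ext <;> simp [edgeSymm, translation] <;> ring

/-- The boundary arc from `corner i j` to `midV i`. -/
def verticalArc (a : ℝ) (i j : Fin 2) : Set (ℝ × ℝ) := edgeSymm i j '' (coord '' arc (3 * a) a)

/-- The left (`i = 0`) and right (`i = 1`) sides of the tile. -/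
def verticalEdge (a : ℝ) (i : Fin 2) : Set (ℝ × ℝ) :=
  translation (i : ℕ) 0 '' (coord '' (separatrix (3 * a) a ∩ square))

end Symmetry

lemma WeakCoupling.of_lt_one_div_three {a : ℝ} (ha0 : 0 < a) (ha1 : a < 1 / 3) :
    WeakCoupling (3 * a) a :=
  ⟨by linarith, by linarith, ha0, by linarith⟩

section Boundary

variable {a : ℝ} (h : WeakCoupling (3 * a) a)

include h

lemma isHeteroclinicCurve_verticalArc (i j : Fin 2) :
    IsHeteroclinicCurve (F a) (corner i j) (midV i) (verticalArc a i j) := by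
  have hcurve := (h.isHeteroclinicCurve_arc.image_of_semiconj coord.continuous coord.injective
    (semiconj_coord a)).image_of_semiconj (continuous_edgeSymm i j) (injective_edgeSymm i j)
    (semiconj_edgeSymm a i j)
  rwa [coord_vertex, coord_zero, edgeSymm_corner, edgeSymm_midV] at hcurve

lemma isHeteroclinicCurve_swap_verticalArc (i j : Fin 2) :
    IsHeteroclinicCurve (F a) (corner i j) (midH j) (Prod.swap '' verticalArc a j i) :=
  (isHeteroclinicCurve_verticalArc h j i).image_of_semiconj continuous_swap Prod.swap_injective
    (semiconj_swap_F a)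

lemma verticalEdge_eq (i : Fin 2) : verticalEdge a i =
    {corner i 0, corner i 1, midV i} ∪ verticalArc a i 0 ∪ verticalArc a i 1 := by
  have hset : separatrix (3 * a) a ∩ square =
      {vertex, -vertex, 0} ∪ arc (3 * a) a ∪ Neg.neg '' arc (3 * a) a := by
    ext z
    simp only [h.mem_separatrix_inter_square_iff, image_neg_eq_neg, mem_union, mem_insert_iff,
      mem_singleton_iff, Set.mem_neg]
    tauto
  simp only [verticalEdge, verticalArc, hset, image_union, image_insert_eq, image_singleton,
    coord_vertex, coord_neg_vertex, coord_zero, image_image]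
  congr 2
  · simp [translation, corner, midV]
  · simp [translation, edgeSymm]
  · funext z
    ext <;> simp [edgeSymm, translation, coord_apply] <;> ring

lemma mem_frontier_basin_F_iff {z : ℝ × ℝ} : z ∈ frontier (basin (F a) (π, π)) ↔
    ∃ i, z ∈ verticalEdge a i ∨ z.swap ∈ verticalEdge a i := by
  obtain ⟨⟨u, v⟩, rfl⟩ := coord.surjective z
  have hmem (i : Fin 2) (w w' : ℝ × ℝ) (hw : translation (i : ℕ) 0 (coord w') = w) :
      w ∈ verticalEdge a i ↔ w' ∈ separatrix (3 * a) a ∩ square := by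
    rw [← hw, verticalEdge, (injective_translation _ _).mem_set_image,
      coord.injective.mem_set_image]
  rw [basin_F_pi_pi, ← coord.image_frontier, coord.injective.mem_set_image,
    h.mem_frontier_basin_sinkPt_iff, Fin.exists_fin_two, hmem 0 _ (u, v), hmem 0 _ (u, π - v),
    hmem 1 _ (u - π, v - π), hmem 1 _ (u - π, -v)]
  · tauto
  all_goals ext <;> simp [translation, coord_apply] <;> ring

theorem frontier_basin_F : frontier (basin (F a) (π, π)) =
    (⋃ i : Fin 2, ⋃ j : Fin 2,
      ({corner i j} ∪ Prod.swap '' verticalArc a j i ∪ verticalArc a i j)) ∪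
      range midH ∪ range midV := by
  ext z
  have hcorner (i j) : z.swap = corner i j ↔ z = corner j i := Prod.swap_eq_iff_eq_swap
  have hmid (i) : z.swap = midV i ↔ z = midH i := Prod.swap_eq_iff_eq_swap
  simp only [mem_frontier_basin_F_iff h, verticalEdge_eq h, image_swap_eq_preimage_swap,
    mem_preimage, mem_union, mem_iUnion, mem_insert_iff, mem_singleton_iff, mem_range,
    Fin.exists_fin_two, hcorner, hmid, eq_comm (b := z)]
  tauto

lemma corner_mem_frontier (i j : Fin 2) : corner i j ∈ frontier (basin (F a) (π, π)) := by
  rw [frontier_basin_F h]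
  exact .inl (.inl (mem_iUnion₂.2 ⟨i, j, .inl (.inl rfl)⟩))

lemma midH_mem_frontier (j : Fin 2) : midH j ∈ frontier (basin (F a) (π, π)) := by
  rw [frontier_basin_F h]
  exact .inl (.inr (mem_range_self j))

lemma midV_mem_frontier (i : Fin 2) : midV i ∈ frontier (basin (F a) (π, π)) := by
  rw [frontier_basin_F h]
  exact .inr (mem_range_self i)

end Boundary

/-! ### The tiling -/

lemma disjoint_interior_closure {X : Type*} [TopologicalSpace X] {U V : Set X} (hV : IsOpen V)
    (hUV : Disjoint U V) : Disjoint (interior (closure U)) (interior (closure V)) :=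
  (((hUV.closure_left hV).mono_left interior_subset).closure_right isOpen_interior).mono_right
    interior_subset

section Basin

variable {a : ℝ}

lemma disjoint_translation_basin {s t : ℤ × ℤ} (hst : s ≠ t) :
    Disjoint (translation s.1 s.2 '' basin (F a) (π, π))
      (translation t.1 t.2 '' basin (F a) (π, π)) := by
  rw [disjoint_left]
  rintro _ ⟨z, hz, rfl⟩ ⟨w, hw, hwz⟩
  have hs := mem_basin_of_semiconj (continuous_translation _ _) (semiconj_translation a s.1 s.2) hz
  have ht := mem_basin_of_semiconj (continuous_translation _ _) (semiconj_translation a t.1 t.2) hw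
  have heq := eq_of_mem_basin hs (hwz ▸ ht)
  simp only [translation, Prod.mk.injEq, add_right_inj, mul_right_inj' two_pi_pos.ne',
    Int.cast_inj] at heq
  exact hst (Prod.ext heq.1 heq.2)

variable (h : WeakCoupling (3 * a) a)

include h

lemma exists_homeomorph_eq_F : ∃ e : ℝ × ℝ ≃ₜ ℝ × ℝ, ⇑e = F a :=
  ⟨coord.symm.trans (h.homeo.trans coord), funext fun z => by
    rw [← coord.apply_symm_apply z, ← (semiconj_coord a).eq, coord.apply_symm_apply]
    rfl⟩

lemma image_closure_basin_F (p : ℝ × ℝ) :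
    F a '' closure (basin (F a) p) = closure (basin (F a) p) := by
  obtain ⟨e, he⟩ := exists_homeomorph_eq_F h
  rw [← he, e.image_closure, image_basin]

lemma image_frontier_basin_F (p : ℝ × ℝ) :
    F a '' frontier (basin (F a) p) = frontier (basin (F a) p) := by
  obtain ⟨e, he⟩ := exists_homeomorph_eq_F h
  rw [← he, e.image_frontier, image_basin]

lemma isOpen_basin_F : IsOpen (basin (F a) (π, π)) := by
  rw [basin_F_pi_pi, coord.isOpen_image]
  exact h.isOpen_basin_sinkPt

lemma isBounded_basin_F : Bornology.IsBounded (basin (F a) (π, π)) := by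
  rw [basin_F_pi_pi]
  exact (h.isBounded_basin_sinkPt.isCompact_closure.image coord.continuous).isBounded.subset
    (image_mono subset_closure)

lemma isSimplyConnected_basin_F : IsSimplyConnected (basin (F a) (π, π)) := by
  rw [basin_F_pi_pi, coord.isSimplyConnected_image]
  exact h.isSimplyConnected_basin_sinkPt

lemma iUnion_translation_closure_basin :
    ⋃ t : ℤ × ℤ, translation t.1 t.2 '' closure (basin (F a) (π, π)) = univ := by
  refine eq_univ_of_forall fun z => ?_
  obtain ⟨w, rfl⟩ := coord.surjective z
  obtain ⟨m, n, ⟨l, hl⟩, hlevel⟩ := h.exists_level_nonneg w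
  refine mem_iUnion.2 ⟨(l, l - n), coord (w.1 - π * m, w.2 - π * n), ?_, ?_⟩
  · rw [basin_F_pi_pi, ← coord.image_closure, h.closure_basin_sinkPt]
    exact mem_image_of_mem _ hlevel
  · have hm : (m : ℝ) = l + l - n := by exact_mod_cast eq_sub_of_add_eq hl
    ext <;> simp only [translation, coord_apply, hm] <;> push_cast <;> ring

theorem isTiling_translation_closure_basin :
    IsTiling fun t : ℤ × ℤ => translation t.1 t.2 '' closure (basin (F a) (π, π)) := by
  have hcl (t : ℤ × ℤ) : translation t.1 t.2 '' closure (basin (F a) (π, π)) =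
      closure (translation t.1 t.2 '' basin (F a) (π, π)) := by
    rw [translation_eq_addRight, Homeomorph.image_closure]
  have hopen (t : ℤ × ℤ) : IsOpen (translation t.1 t.2 '' basin (F a) (π, π)) := by
    rw [translation_eq_addRight, Homeomorph.isOpen_image]
    exact isOpen_basin_F h
  refine ⟨fun t => ⟨by simp only [hcl, isClosed_closure], ?_⟩, iUnion_translation_closure_basin h,
    fun s t hst => ?_⟩
  · exact ((isSimplyConnected_basin_F h).nonempty.image _).mono
      (interior_maximal (image_mono subset_closure) (hopen t))
  · simpa only [hcl] using disjoint_interior_closure (hopen t) (disjoint_translation_basin hst)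

lemma image_translation_closure_basin (l k : ℤ) :
    F a '' (translation l k '' closure (basin (F a) (π, π))) =
      translation l k '' closure (basin (F a) (π, π)) := by
  rw [← image_comp, ← (semiconj_translation a l k).comp_eq, image_comp, image_closure_basin_F h]

end Basin

section Saddles

variable {a : ℝ} (h : WeakCoupling (3 * a) a)

include h

lemma sqrt_three_mul_lt_two : √3 * a < 2 := by
  have hsqrt : √3 ≤ 3 := Real.sqrt_le_iff.2 (by norm_num)
  nlinarith [h.b_lt_one, h.c_pos]

lemma isSaddleIn_of_semiconj {σ : ℝ × ℝ → ℝ × ℝ} (hσ : Continuous σ) (hi : Injective σ)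
    (hF : Semiconj σ (F a) (F a)) (hsink : σ (π, π) = (π, π))
    (hsaddle : IsSaddle (F a) (σ (midV 0))) :
    IsSaddleIn (F a) (closure (basin (F a) (π, π))) (σ (midV 0)) := by
  have hin := h.isSaddleIn_closure_basin (φ := σ ∘ coord) (hσ.comp coord.continuous)
    (hi.comp coord.injective) (hF.comp_left (semiconj_coord a))
  simp only [comp_apply, coord_zero, coord_sinkPt, hsink] at hin
  exact hin hsaddle

lemma isSaddleIn_midV (i : Fin 2) :
    IsSaddleIn (F a) (closure (basin (F a) (π, π))) (midV i) := by
  have hsaddle := isSaddle_F_midV h.c_pos (sqrt_three_mul_lt_two h) i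
  rw [← edgeSymm_midV i i] at hsaddle ⊢
  exact isSaddleIn_of_semiconj h (continuous_edgeSymm i i) (injective_edgeSymm i i)
    (semiconj_edgeSymm a i i) (edgeSymm_pi_pi i) hsaddle

lemma isSaddleIn_midH (j : Fin 2) :
    IsSaddleIn (F a) (closure (basin (F a) (π, π))) (midH j) := by
  have hmid : (Prod.swap ∘ edgeSymm j j) (midV 0) = midH j :=
    congrArg Prod.swap (edgeSymm_midV j j)
  have hsaddle := isSaddle_F_midH h.c_pos (sqrt_three_mul_lt_two h) j
  rw [← hmid] at hsaddle ⊢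
  exact isSaddleIn_of_semiconj h (continuous_swap.comp (continuous_edgeSymm j j))
    (Prod.swap_injective.comp (injective_edgeSymm j j))
    ((semiconj_swap_F a).comp_left (semiconj_edgeSymm a j j))
    (congrArg Prod.swap (edgeSymm_pi_pi j)) hsaddle

end Saddles

theorem mainTheorem1_general (a : ℝ) (ha0 : 0 < a) (ha1 : a < 1 / 3) :
    IsSink (F a) (π, π) ∧
    ∃ A : Set (ℝ × ℝ),
      A = basin (F a) (π, π) ∧
      (π, π) ∈ A ∧
      IsOpen A ∧ Bornology.IsBounded A ∧ IsSimplyConnected A ∧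
      (∀ i j : Fin 2, corner i j ∈ frontier A ∧ IsRepellerIn (F a) (closure A) (corner i j)) ∧
      (∀ j : Fin 2, midH j ∈ frontier A ∧ IsSaddleIn (F a) (closure A) (midH j)) ∧
      (∀ i : Fin 2, midV i ∈ frontier A ∧ IsSaddleIn (F a) (closure A) (midV i)) ∧
      (∃ H V : Fin 2 → Fin 2 → Set (ℝ × ℝ),
        (∀ i j : Fin 2, IsHeteroclinicCurve (F a) (corner i j) (midH j) (H i j)) ∧
        (∀ i j : Fin 2, IsHeteroclinicCurve (F a) (corner i j) (midV i) (V i j)) ∧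
        frontier A =
          (⋃ i : Fin 2, ⋃ j : Fin 2, ({corner i j} ∪ H i j ∪ V i j)) ∪ range midH ∪ range midV) ∧
      F a '' frontier A = frontier A ∧
      IsTiling (fun t : ℤ × ℤ => translation t.1 t.2 '' closure A) ∧
      (∀ l k : ℤ,
        Semiconj (translation l k) (F a) (F a) ∧
        F a '' (translation l k '' closure A) = translation l k '' closure A) := by
  have h := WeakCoupling.of_lt_one_div_three ha0 ha1
  exact ⟨isSink_F_pi_pi ha0 (by linarith), basin (F a) (π, π), rfl,
    self_mem_basin (F_eq_self sin_pi sin_pi), isOpen_basin_F h, isBounded_basin_F h,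
    isSimplyConnected_basin_F h,
    fun i j => ⟨corner_mem_frontier h i j, frontier_subset_closure (corner_mem_frontier h i j),
      isRepeller_F_corner ha0 i j⟩,
    fun j => ⟨midH_mem_frontier h j, isSaddleIn_midH h j⟩,
    fun i => ⟨midV_mem_frontier h i, isSaddleIn_midV h i⟩,
    ⟨fun i j => Prod.swap '' verticalArc a j i, verticalArc a,
      isHeteroclinicCurve_swap_verticalArc h, isHeteroclinicCurve_verticalArc h,
      frontier_basin_F h⟩,
    image_frontier_basin_F h _, isTiling_translation_closure_basin h,
    fun l k => ⟨semiconj_translation a l k, image_translation_closure_basin h l k⟩⟩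

end AlignedClocks

end

theorem mainTheorem1 (a : ℝ) (ha0 : 0 < a) (ha1 : a < 1 / 6) :
    AlignedClocks.IsSink (AlignedClocks.F a) (Real.pi, Real.pi) ∧
    ∃ A : Set (ℝ × ℝ),
      -- `A` is the basin of attraction of the sink; it is bounded, open and simply connected
      A = AlignedClocks.basin (AlignedClocks.F a) (Real.pi, Real.pi) ∧
      (Real.pi, Real.pi) ∈ A ∧
      IsOpen A ∧ Bornology.IsBounded A ∧ IsSimplyConnected A ∧
      -- repellers and saddles on the boundary
      (∀ i j : Fin 2, AlignedClocks.corner i j ∈ frontier A ∧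
        AlignedClocks.IsRepellerIn (AlignedClocks.F a) (closure A) (AlignedClocks.corner i j)) ∧
      (∀ j : Fin 2, AlignedClocks.midH j ∈ frontier A ∧
        AlignedClocks.IsSaddleIn (AlignedClocks.F a) (closure A) (AlignedClocks.midH j)) ∧
      (∀ i : Fin 2, AlignedClocks.midV i ∈ frontier A ∧
        AlignedClocks.IsSaddleIn (AlignedClocks.F a) (closure A) (AlignedClocks.midV i)) ∧
      -- the boundary consists of these eight points and eight heteroclinic curves, one from each
      -- repeller to each of the two adjacent saddles
      (∃ H V : Fin 2 → Fin 2 → Set (ℝ × ℝ),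
        (∀ i j : Fin 2, AlignedClocks.IsHeteroclinicCurve (AlignedClocks.F a)
          (AlignedClocks.corner i j) (AlignedClocks.midH j) (H i j)) ∧
        (∀ i j : Fin 2, AlignedClocks.IsHeteroclinicCurve (AlignedClocks.F a)
          (AlignedClocks.corner i j) (AlignedClocks.midV i) (V i j)) ∧
        frontier A =
          (⋃ i : Fin 2, ⋃ j : Fin 2, ({AlignedClocks.corner i j} ∪ H i j ∪ V i j)) ∪
            Set.range AlignedClocks.midH ∪ Set.range AlignedClocks.midV) ∧
      -- strong invariance of the boundary
      AlignedClocks.F a '' frontier A = frontier A ∧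
      -- the translates of the closure tile the plane, with the same dynamics on each tile
      AlignedClocks.IsTiling
        (fun t : ℤ × ℤ => AlignedClocks.translation t.1 t.2 '' closure A) ∧
      (∀ l k : ℤ,
        Function.Semiconj (AlignedClocks.translation l k) (AlignedClocks.F a)
          (AlignedClocks.F a) ∧
        AlignedClocks.F a '' (AlignedClocks.translation l k '' closure A) =
          AlignedClocks.translation l k '' closure A) :=
  AlignedClocks.mainTheorem1_general a ha0 (by linarith)
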